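/- Permutations of $\{1,\dots,n\}$ are written as words $\sigma=\sigma_1\cdots\sigma_n$. The pinnacle set of $\sigma$ is $\mathrm{Pin}(\sigma)=\{\sigma_i : 1<i<n,\ \sigma_{i-1}<\sigma_i>\sigma_{i+1}\}$. Let $\mathfrak P_n(S)$ be the set of permutations of $\{1,\dots,n\}$ with pinnacle set $S$, and $p_n(S)=\#\mathfrak P_n(S)$. A finite set $S$ is called a pinnacle set if $\mathfrak P_m(S)\neq\emptyset$ for some $m$. For a letter $k$ of $\sigma$ write $\sigma=\alpha\,\beta\,k\,\gamma\,\delta$, where $\beta$ (resp. $\gamma$) is the longest consecutive run of letters smaller than $k$ immediately to the left (resp. right) of $k$, and put $\varphi_k(\sigma)=\alpha\,\gamma\,k\,\beta\,\delta$. The maps $\varphi_k$ generate the modified (dual) Foata–Strehl action; the orbit of $\sigma$ is the set of all words obtained from $\sigma$ by applying finitely many of these maps. For a pinnacle set $S$ and $n\ge \max S$, the sets $\mathfrak P'_n(S)$ are defined inductively, with $\mathfrak P'_n(S)=\emptyset$ if $S$ is not a pinnacle set. The set $\mathfrak P'_n(\emptyset)$ consists of the word $1\,2\cdots n$ only. If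 $n>\max S$, then $\mathfrak P'_n(S)$ is obtained by adding the letter $n$ to the right of every element of $\mathfrak P'_{n-1}(S)$. If $n=\max S$, let $t$ be the largest value smaller than $n$ that is not in $S$, and $T=\{s\in S: s<t\}$, so that $S=T\cup\{t+1,\dots,n\}$. Then $\mathfrak P'_n(S)$ is the union of: (1) the words obtained from the elements of $\mathfrak P'_n(T\cup\{t,t+2,t+3,\dots,n\})$ by exchanging the values $t$ and $t+1$; (2) the words obtained from the elements of $\mathfrak P'_{n-1}(T\cup\{t,t+1,\dots,n-1\})$ by replacing each letter $x$ by $x$ if $x<t$, by $t,\,t+1$ if $x=t$, and by $x+1$ if $x>t$; (3) for each $q$ with $t\le q\le n-2$, the words obtained from the elements of $\mathfrak P'_{n-2}(T\cup\{t,t+1,\dots,n-2\})$ by replacing each letter $x$ by $x$ if $x<t$, by $t+1,\,t,\,x+2$ if $x=q$, and by $x+2$ otherwise; and also the words obtained from the elements of the same set by replacing each letter $x\ge t$ by $x+2$ and then adding $t+1,\,t$ at the right end. **Theorem.** Let $n\ge 1$ and let $S$ be a pinnacle set with all elements at most $n$. Then $\mathfrak P_n(S)$ is stable under the modified Foata–Strehl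 action, and $\mathfrak P'_n(S)$ is exactly the set of those $\sigma\in\mathfrak P_n(S)$ that are the lexicographically smallest element of their orbit. Moreover $\#\mathfrak P'_n(S)\cdot 2^{\,n-1-|S|}=p_n(S)$. -/

import Mathlib

open Finset

namespace Pinnacle

/-- The permutations of `{1, …, n}`, as words in one-line notation. -/
def permWords (n : ℕ) : Set (List ℕ) :=
  {σ | σ.Perm (List.range' 1 n)}

/-- The pinnacle set of a word: the values of the letters that are larger than both
of their (existing) neighbours. -/
def pin (σ : List ℕ) : Set ℕ :=
  {b | ∃ (u v : List ℕ) (a c : ℕ), σ = u ++ a :: b :: c :: v ∧ a < b ∧ c < b}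

/-- `permsWithPin n S` is the set of permutations of `{1, …, n}` with pinnacle set `S`. -/
def permsWithPin (n : ℕ) (S : Finset ℕ) : Set (List ℕ) :=
  {σ | σ ∈ permWords n ∧ pin σ = (S : Set ℕ)}

/-- `p n S` is the number of permutations of `{1, …, n}` with pinnacle set `S`. -/
noncomputable def p (n : ℕ) (S : Finset ℕ) : ℕ :=
  (permsWithPin n S).ncard

/-- An (admissible) pinnacle set is the pinnacle set of some permutation, of any size. -/
def IsPinnacleSet (S : Finset ℕ) : Prop :=
  ∃ m : ℕ, (permsWithPin m S).Nonempty

/-! The factorization `σ = α β k γ δ` of a word according to one of its letters `k`: `β` and `γ`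
are the longest runs of letters smaller than `k` immediately to the left and right of `k`. -/

/-- The letters of `σ` to the left of `k`. -/
def leftOf (k : ℕ) (σ : List ℕ) : List ℕ :=
  σ.takeWhile (fun x => decide (x ≠ k))

/-- The letters of `σ` to the right of `k`. -/
def rightOf (k : ℕ) (σ : List ℕ) : List ℕ :=
  (σ.dropWhile (fun x => decide (x ≠ k))).tail

/-- The factor `α` of the factorization according to `k`. -/
def factorα (k : ℕ) (σ : List ℕ) : List ℕ :=
  (leftOf k σ).rdropWhile (fun x => decide (x < k))

/-- The factor `β` of the factorization according to `k`. -/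
def factorβ (k : ℕ) (σ : List ℕ) : List ℕ :=
  (leftOf k σ).rtakeWhile (fun x => decide (x < k))

/-- The factor `γ` of the factorization according to `k`. -/
def factorγ (k : ℕ) (σ : List ℕ) : List ℕ :=
  (rightOf k σ).takeWhile (fun x => decide (x < k))

/-- The factor `δ` of the factorization according to `k`. -/
def factorδ (k : ℕ) (σ : List ℕ) : List ℕ :=
  (rightOf k σ).dropWhile (fun x => decide (x < k))

/-- The generator `φ_k` of the modified (dual) Foata–Strehl action:
`α β k γ δ ↦ α γ k β δ` if `k` is a letter of the word (and the identity otherwise). -/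
def phi (k : ℕ) (σ : List ℕ) : List ℕ :=
  if k ∈ σ then factorα k σ ++ factorγ k σ ++ [k] ++ factorβ k σ ++ factorδ k σ else σ

/-- The orbit of `σ` under the modified Foata–Strehl action: everything that is obtained from
`σ` by applying finitely many of the maps `φ_k`, with `k` a letter. -/
def fsOrbit (σ : List ℕ) : Set (List ℕ) :=
  {τ | Relation.ReflTransGen (fun w w' : List ℕ => ∃ k ∈ w, w' = phi k w) σ τ}

/-- The substitution `x ↦ x` if `x < t`, `t ↦ t, t+1`, `x ↦ x + 1` if `x > t`. -/
def substTwo (t x : ℕ) : List ℕ :=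
  if x < t then [x] else if x = t then [t, t + 1] else [x + 1]

/-- The substitution `x ↦ x` if `x < t`, `q ↦ t+1, t, q+2`, and `x ↦ x + 2` otherwise. -/
def substThree (t q x : ℕ) : List ℕ :=
  if x < t then [x] else if x = q then [t + 1, t, x + 2] else [x + 2]

/-- The substitution `x ↦ x` if `x < t`, and `x ↦ x + 2` otherwise. -/
def shiftTwo (t x : ℕ) : ℕ :=
  if x < t then x else x + 2

/-- `IsBlock S T t n` : `S` is a pinnacle set with maximum `n`, `t` is the largest value smaller
than `n` that is not in `S`, and `T = {s ∈ S | s < t}`; so `S = T ∪ {t+1, …, n}`. -/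
def IsBlock (S T : Finset ℕ) (t n : ℕ) : Prop :=
  IsPinnacleSet S ∧ t < n ∧ (∀ s ∈ T, s < t) ∧ S = T ∪ Icc (t + 1) n

/-- `InPPrime n S σ` : the word `σ` belongs to the inductively defined set `𝔓'_n(S)`. -/
inductive InPPrime : ℕ → Finset ℕ → List ℕ → Prop
  /-- `𝔓'_n(∅)` consists of the identity `1 … n`. -/
  | identity (n : ℕ) : InPPrime n ∅ (List.range' 1 n)
  /-- If `n + 1 > max S`, the letter `n + 1` is added to the right of the words of `𝔓'_n(S)`. -/
  | append (n : ℕ) (S : Finset ℕ) (σ : List ℕ) (hS : ∀ s ∈ S, s ≤ n) (hσ : InPPrime n S σ) :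
      InPPrime (n + 1) S (σ ++ [n + 1])
  /-- Exchange `t` and `t + 1` in the words of `𝔓'_n(T ∪ {t, t+2, t+3, …, n})`. -/
  | first (n t : ℕ) (S T : Finset ℕ) (σ : List ℕ) (hS : IsBlock S T t n)
      (hσ : InPPrime n (T ∪ {t} ∪ Icc (t + 2) n) σ) :
      InPPrime n S (σ.map (Equiv.swap t (t + 1)))
  /-- Apply `substTwo` to the words of `𝔓'_{n-1}(T ∪ {t, …, n-1})`; here `n = m + 1`. -/
  | second (m t : ℕ) (S T : Finset ℕ) (σ : List ℕ) (hS : IsBlock S T t (m + 1))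
      (hσ : InPPrime m (T ∪ Icc t m) σ) :
      InPPrime (m + 1) S (σ.flatMap (substTwo t))
  /-- Apply `substThree`, for a value `q` with `t ≤ q ≤ n - 2`, to the words of
  `𝔓'_{n-2}(T ∪ {t, …, n-2})`; here `n = m + 2`. -/
  | third (m t q : ℕ) (S T : Finset ℕ) (σ : List ℕ) (hS : IsBlock S T t (m + 2))
      (hq : t ≤ q ∧ q ≤ m) (hσ : InPPrime m (T ∪ Icc t m) σ) :
      InPPrime (m + 2) S (σ.flatMap (substThree t q))
  /-- Shift the values `≥ t` of the words of `𝔓'_{n-2}(T ∪ {t, …, n-2})` by two and glue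
  `t + 1, t` to their right; here `n = m + 2`. -/
  | glue (m t : ℕ) (S T : Finset ℕ) (σ : List ℕ) (hS : IsBlock S T t (m + 2))
      (hσ : InPPrime m (T ∪ Icc t m) σ) :
      InPPrime (m + 2) S (σ.map (shiftTwo t) ++ [t + 1, t])

/-- The set `𝔓'_n(S)`. -/
def PPrime (n : ℕ) (S : Finset ℕ) : Set (List ℕ) :=
  {σ | InPPrime n S σ}

end Pinnacle

/-!
A word without repeated letters is read as a decreasing binary tree: its largest letter `k` is the
root, and the words `β`, `γ` in `β ++ k :: γ` are the left and the right subtree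
(`nodup_max_induction`). The pinnacles are the vertices with two children (`mem_pin_node`), and
`φ_k` exchanges the two subtrees of the vertex `k`. Hence the elements of an orbit arise by
exchanging subtrees independently at all vertices (`mem_fsOrbit_node`): the pinnacle set is
constant on an orbit, and the orbit has `2 ^ d` elements, where `d` is the number of vertices with
at least one child. As a binary tree has one more leaf than it has vertices with two children,
`d = n - 1 - |S|`.

To make a word lexicographically small, each only child has to be on the left, and so has, of
two siblings, the subtree whose word starts with the smaller letter. In a word with this property
the first letter of every subtree is the smallest one, so the property can be stated without
reference to the orbit; it is called `Canon`. The canonical words are exactly the least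
elements of their orbits (`isLeast_fsOrbit_iff`).

It remains to see that the inductive construction produces exactly the canonical words. If `n` is
not a pinnacle, it is the root and has no right subtree, so it is the last letter. Otherwise let
`t` be the largest value which is not a pinnacle, and look at the position of `t` relative to
`t + 1`, which has two children.

* If `t` is the left child of `t + 1`, then it has no right child in a canonical word, so the
  word contains the factor `t, t + 1`. The two letters are merged into one
  (`canon_flatMap_substTwo_iff`).
* If `t` is a leaf and the right child of `t + 1`, the word contains `t + 1, t`, followed by a
  larger letter or by nothing, and these two letters can be cut out (`canon_insert_iff`).
* In all other cases exchanging `t` and `t + 1` keeps the word canonical and turns `t` into a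
  pinnacle in place of `t + 1` (`map_swap_of_succ_mem_pin`); conversely the exchange is always
  possible when `t` is a pinnacle and `t + 1` is not (`map_swap_of_mem_pin`).

The size of the permutation or the sum of its pinnacles drops in each case, which gives
`inPPrime_of_isCanonPerm`; the converse is `isCanonPerm_of_inPPrime`.
-/

namespace Pinnacle

/-! ### Words and decreasing trees -/

theorem mem_permWords {n : ℕ} {σ : List ℕ} :
    σ ∈ permWords n ↔ σ.Nodup ∧ ∀ x, x ∈ σ ↔ 1 ≤ x ∧ x ≤ n := by
  have hr : ∀ x, x ∈ List.range' 1 n ↔ 1 ≤ x ∧ x ≤ n := by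
    intro x; rw [List.mem_range'_1]; omega
  constructor
  · intro h
    have h : σ.Perm (List.range' 1 n) := h
    exact ⟨h.nodup_iff.2 List.nodup_range', fun x => h.mem_iff.trans (hr x)⟩
  · rintro ⟨h1, h2⟩
    exact (List.perm_ext_iff_of_nodup h1 List.nodup_range').2 fun x => (h2 x).trans (hr x).symm

/-- Induction on a word without repeated letters along its decreasing binary tree: the largest
letter `k` is the root, and the words on its two sides are the subtrees. -/
@[elab_as_elim]
theorem nodup_max_induction {P : ∀ σ : List ℕ, σ.Nodup → Prop} (nil : P [] List.nodup_nil)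
    (node : ∀ β k γ (hd : (β ++ k :: γ).Nodup), (∀ x ∈ β, x < k) → (∀ x ∈ γ, x < k) →
      P β (List.nodup_append.1 hd).1 → P γ (List.nodup_append.1 hd).2.1.of_cons →
      P (β ++ k :: γ) hd)
    (σ : List ℕ) (hσ : σ.Nodup) : P σ hσ := by
  induction hl : σ.length using Nat.strong_induction_on generalizing σ with
  | _ l ih =>
    by_cases h0 : σ = []
    · subst h0; exact nil
    obtain ⟨k, hk, hmax⟩ := σ.toFinset.exists_max_image id (by simpa using h0)
    simp only [List.mem_toFinset, id] at hk hmax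
    obtain ⟨β, γ, rfl⟩ := List.append_of_mem hk
    have hd := hσ
    simp only [List.nodup_append, List.nodup_cons, List.mem_cons] at hd
    have hβ : ∀ x ∈ β, x < k := fun x hx =>
      lt_of_le_of_ne (hmax x (by simp [hx])) (hd.2.2 x hx k (Or.inl rfl))
    have hγ : ∀ x ∈ γ, x < k := fun x hx =>
      lt_of_le_of_ne (hmax x (by simp [hx])) (by rintro rfl; exact hd.2.1.1 hx)
    simp only [List.length_append, List.length_cons] at hl
    exact node β k γ hσ hβ hγ (ih β.length (by omega) β _ rfl)
      (ih γ.length (by omega) γ _ rfl)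

theorem node_eq_iff {β γ β' γ' : List ℕ} {k k' : ℕ} (hβ : ∀ x ∈ β, x < k)
    (hγ : ∀ x ∈ γ, x < k) (hβ' : ∀ x ∈ β', x < k') (hγ' : ∀ x ∈ γ', x < k') :
    β ++ k :: γ = β' ++ k' :: γ' ↔ β = β' ∧ k = k' ∧ γ = γ' := by
  refine ⟨fun h => ?_, by rintro ⟨rfl, rfl, rfl⟩; rfl⟩
  have hk : k = k' := by
    have h1 : k ∈ β' ++ k' :: γ' := h ▸ by simp
    have h2 : k' ∈ β ++ k :: γ := h ▸ by simp
    simp only [List.mem_append, List.mem_cons] at h1 h2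
    grind
  subst hk
  rcases List.append_eq_append_iff.1 h with ⟨as, h1, h2⟩ | ⟨as, h1, h2⟩ <;>
    cases as <;> simp_all
  · exact absurd (hγ k (Or.inr (Or.inl h2.1))) (by omega)
  · exact absurd (hβ k (Or.inr (Or.inl h2.1))) (by omega)

/-! ### Pinnacles -/

theorem mem_pin_cons {b x : ℕ} {l : List ℕ} :
    b ∈ pin (x :: l) ↔ b ∈ pin l ∨ ∃ c v, l = b :: c :: v ∧ x < b ∧ c < b := by
  constructor
  · rintro ⟨u, v, a, c, h, h1, h2⟩
    cases u with
    | nil =>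
      simp only [List.nil_append, List.cons.injEq] at h
      exact Or.inr ⟨c, v, h.2, h.1 ▸ h1, h2⟩
    | cons y u =>
      simp only [List.cons_append, List.cons.injEq] at h
      exact Or.inl ⟨u, v, a, c, h.2, h1, h2⟩
  · rintro (⟨u, v, a, c, rfl, h1, h2⟩ | ⟨c, v, rfl, h1, h2⟩)
    · exact ⟨x :: u, v, a, c, rfl, h1, h2⟩
    · exact ⟨[], v, x, c, rfl, h1, h2⟩

@[simp] theorem pin_nil : pin [] = ∅ := by
  ext b; simp [pin]

@[simp] theorem pin_singleton (x : ℕ) : pin [x] = ∅ := by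
  ext b; simp [mem_pin_cons]

theorem pin_cons_cons_of_gt {a c : ℕ} (h : c < a) (v : List ℕ) :
    pin (a :: c :: v) = pin (c :: v) := by
  ext b
  rw [mem_pin_cons, or_iff_left]
  rintro ⟨c', v', h1, h2, h3⟩
  simp only [List.cons.injEq] at h1
  omega

/-- A word can be cut inside an ascent `a < c`: the letter `a` is not a pinnacle, and whether `c`
is one is visible from the right part, which keeps `a`. -/
theorem pin_append_of_lt {a c : ℕ} (h : a < c) (u v : List ℕ) :
    pin (u ++ a :: c :: v) = pin (u ++ [a]) ∪ pin (a :: c :: v) := by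
  induction u with
  | nil => simp
  | cons x u ih =>
    ext b
    have : (∃ c' v', u ++ a :: c :: v = b :: c' :: v' ∧ x < b ∧ c' < b) ↔
        ∃ c' v', u ++ [a] = b :: c' :: v' ∧ x < b ∧ c' < b := by
      rcases u with _ | ⟨y, _ | ⟨z, u⟩⟩
      · simp; omega
      · simp
      · simp
    rw [List.cons_append, mem_pin_cons, ih, this, List.cons_append, Set.mem_union, Set.mem_union,
      mem_pin_cons (x := x)]
    exact or_right_comm

/-- The recursive description of the pinnacle set: the root of the decreasing tree is a pinnacle
iff both of its subtrees are nonempty. -/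
theorem mem_pin_node {β γ : List ℕ} {k : ℕ} (hβ : ∀ x ∈ β, x < k) (hγ : ∀ x ∈ γ, x < k)
    {b : ℕ} :
    b ∈ pin (β ++ k :: γ) ↔ b ∈ pin β ∨ b ∈ pin γ ∨ (b = k ∧ β ≠ [] ∧ γ ≠ []) := by
  have hr : pin (k :: γ) = pin γ := by
    cases γ with
    | nil => simp
    | cons c γ => exact pin_cons_cons_of_gt (hγ c (by simp)) γ
  rcases List.eq_nil_or_concat β with rfl | ⟨β, a, rfl⟩
  · simp [hr]
  · have ha : a < k := hβ a (by simp)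
    rw [List.concat_eq_append, List.append_assoc, List.singleton_append, pin_append_of_lt ha,
      Set.mem_union, mem_pin_cons, hr]
    cases γ with
    | nil => simp
    | cons c γ =>
      have hc : c < k := hγ c (by simp)
      simp only [List.cons.injEq, ne_eq, List.append_eq_nil_iff, reduceCtorEq, not_false_eq_true,
        and_true, and_false]
      constructor
      · rintro (h | h | ⟨_, _, ⟨h, _⟩, _⟩)
        exacts [Or.inl h, Or.inr (Or.inl h), Or.inr (Or.inr h.symm)]
      · rintro (h | h | rfl)
        exacts [Or.inl h, Or.inr (Or.inl h), Or.inr (Or.inr ⟨c, γ, ⟨rfl, rfl, rfl⟩, ha, hc⟩)]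

theorem mem_of_mem_pin {σ : List ℕ} {b : ℕ} (h : b ∈ pin σ) : b ∈ σ := by
  obtain ⟨u, v, a, c, rfl, -, -⟩ := h
  simp

theorem exists_lt_of_mem_pin {σ : List ℕ} {b : ℕ} (h : b ∈ pin σ) : ∃ a ∈ σ, a < b := by
  obtain ⟨u, v, a, c, rfl, h, -⟩ := h
  exact ⟨a, by simp, h⟩

theorem neighbours_lt_of_mem_pin {u v : List ℕ} {b : ℕ} (hd : (u ++ b :: v).Nodup)
    (h : b ∈ pin (u ++ b :: v)) :
    (∃ u' a, u = u' ++ [a] ∧ a < b) ∧ ∃ c v', v = c :: v' ∧ c < b := by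
  obtain ⟨u', v', a, c, h, ha, hc⟩ := h
  have h' : u ++ b :: v = (u' ++ [a]) ++ b :: (c :: v') := by simpa using h
  have hd' := h' ▸ hd
  obtain ⟨rfl, rfl⟩ : u = u' ++ [a] ∧ v = c :: v' := by
    rcases List.append_eq_append_iff.1 h' with ⟨as, h1, h2⟩ | ⟨as, h1, h2⟩ <;>
    rcases as with _ | ⟨y, as⟩
    · simp_all
    · simp only [List.cons_append, List.cons.injEq] at h2
      rw [h1, ← h2.1] at hd'
      simp [List.nodup_append] at hd'
    · simp_all
    · simp only [List.cons_append, List.cons.injEq] at h2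
      rw [h1, ← h2.1] at hd
      simp [List.nodup_append] at hd
  exact ⟨⟨u', a, rfl, ha⟩, ⟨c, v', rfl, hc⟩⟩

theorem head_notMem_pin {b : ℕ} {v : List ℕ} (hd : (b :: v).Nodup) : b ∉ pin (b :: v) := by
  intro h
  obtain ⟨⟨u, a, h, -⟩, -⟩ := neighbours_lt_of_mem_pin (u := []) hd h
  simp at h

theorem pin_finite (σ : List ℕ) : (pin σ).Finite :=
  σ.toFinset.finite_toSet.subset fun _ hb => by simpa using mem_of_mem_pin hb

/-! ### The action on decreasing trees -/

theorem phi_node {β γ : List ℕ} {k : ℕ} (hβ : ∀ x ∈ β, x < k) (hγ : ∀ x ∈ γ, x < k) :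
    phi k (β ++ k :: γ) = γ ++ k :: β := by
  have h1 : leftOf k (β ++ k :: γ) = β := by
    rw [leftOf, List.takeWhile_append_of_pos]
    · simp
    · intro x hx; simpa using (hβ x hx).ne
  have h2 : rightOf k (β ++ k :: γ) = γ := by
    rw [rightOf, List.dropWhile_append_of_pos]
    · simp
    · intro x hx; simpa using (hβ x hx).ne
  have h3 : factorα k (β ++ k :: γ) = [] := by
    rw [factorα, h1, List.rdropWhile_eq_nil_iff]; simpa using hβ
  have h4 : factorβ k (β ++ k :: γ) = β := by
    rw [factorβ, h1, List.rtakeWhile_eq_self_iff]; simpa using hβ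
  have h5 : factorγ k (β ++ k :: γ) = γ := by
    rw [factorγ, h2, List.takeWhile_eq_self_iff]; simpa using hγ
  have h6 : factorδ k (β ++ k :: γ) = [] := by
    rw [factorδ, h2, List.dropWhile_eq_nil_iff]; simpa using hγ
  simp [phi, h3, h4, h5, h6]

theorem takeWhile_append_of_exists {p : ℕ → Bool} {u v : List ℕ} (h : ∃ x ∈ u, p x = false) :
    (u ++ v).takeWhile p = u.takeWhile p := by
  induction u with
  | nil => simp at h
  | cons a u ih =>
    cases hp : p a
    · simp [hp]
    · have : ∃ x ∈ u, p x = false := by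
        obtain ⟨x, hx, hpx⟩ := h
        rcases List.mem_cons.1 hx with rfl | hx
        · simp [hp] at hpx
        · exact ⟨x, hx, hpx⟩
      simp [hp, ih this]

theorem dropWhile_append_of_exists {p : ℕ → Bool} {u v : List ℕ} (h : ∃ x ∈ u, p x = false) :
    (u ++ v).dropWhile p = u.dropWhile p ++ v := by
  induction u with
  | nil => simp at h
  | cons a u ih =>
    cases hp : p a
    · simp [hp]
    · have : ∃ x ∈ u, p x = false := by
        obtain ⟨x, hx, hpx⟩ := h
        rcases List.mem_cons.1 hx with rfl | hx
        · simp [hp] at hpx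
        · exact ⟨x, hx, hpx⟩
      simp [hp, ih this]

theorem takeWhile_append_cons {p : ℕ → Bool} {u v : List ℕ} {k : ℕ} (h : p k = false) :
    (u ++ k :: v).takeWhile p = u.takeWhile p := by
  induction u with
  | nil => simp [h]
  | cons a u ih => cases hp : p a <;> simp [hp, ih]

theorem dropWhile_append_cons {p : ℕ → Bool} {u v : List ℕ} {k : ℕ} (h : p k = false) :
    (u ++ k :: v).dropWhile p = u.dropWhile p ++ k :: v := by
  induction u with
  | nil => simp [h]
  | cons a u ih => cases hp : p a <;> simp [hp, ih]

theorem phi_append_cons_of_mem_left {β : List ℕ} {j k : ℕ} (hj : j ∈ β) (hjk : j < k)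
    (γ : List ℕ) : phi j (β ++ k :: γ) = phi j β ++ k :: γ := by
  have h1 : leftOf j (β ++ k :: γ) = leftOf j β :=
    takeWhile_append_of_exists ⟨j, hj, by simp⟩
  have h2 : rightOf j (β ++ k :: γ) = rightOf j β ++ k :: γ := by
    rw [rightOf, dropWhile_append_of_exists ⟨j, hj, by simp⟩, List.tail_append_of_ne_nil]
    · rfl
    · rw [Ne, List.dropWhile_eq_nil_iff]
      intro h
      simpa using h j hj
  have hk : decide (k < j) = false := by simpa using hjk.le
  have h3 : factorγ j (β ++ k :: γ) = factorγ j β := by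
    rw [factorγ, h2, takeWhile_append_cons hk]; rfl
  have h4 : factorδ j (β ++ k :: γ) = factorδ j β ++ k :: γ := by
    rw [factorδ, h2, dropWhile_append_cons hk]; rfl
  simp [phi, hj, h3, h4, factorα, factorβ, h1]

theorem phi_append_cons_of_mem_right {β γ : List ℕ} {j k : ℕ} (hj : j ∈ γ) (hjβ : j ∉ β)
    (hjk : j < k) : phi j (β ++ k :: γ) = β ++ k :: phi j γ := by
  have hp : ∀ x ∈ β ++ [k], (fun x => decide (x ≠ j)) x = true := by
    intro x hx
    simp only [List.mem_append, List.mem_singleton] at hx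
    have : x ≠ j := by rintro rfl; rcases hx with hx | hx; exacts [hjβ hx, hjk.ne hx]
    simpa using this
  have e : β ++ k :: γ = (β ++ [k]) ++ γ := by simp
  have h1 : leftOf j (β ++ k :: γ) = (β ++ [k]) ++ leftOf j γ := by
    rw [e, leftOf, List.takeWhile_append_of_pos hp]; rfl
  have h2 : rightOf j (β ++ k :: γ) = rightOf j γ := by
    rw [e, rightOf, List.dropWhile_append_of_pos hp]; rfl
  have hk : decide (k < j) = false := by simpa using hjk.le
  have h3 : factorα j (β ++ k :: γ) = β ++ k :: factorα j γ := by
    rw [factorα, h1, List.rdropWhile, List.reverse_append, List.reverse_append,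
      List.reverse_singleton, List.singleton_append, dropWhile_append_cons hk]
    simp [factorα, List.rdropWhile]
  have h4 : factorβ j (β ++ k :: γ) = factorβ j γ := by
    rw [factorβ, h1, List.rtakeWhile, List.reverse_append, List.reverse_append,
      List.reverse_singleton, List.singleton_append, takeWhile_append_cons hk]
    rfl
  simp [phi, hj, h3, h4, factorγ, factorδ, h2]

theorem phi_perm (k : ℕ) (σ : List ℕ) : (phi k σ).Perm σ := by
  unfold phi
  split_ifs with hk
  · have h1 : factorα k σ ++ factorβ k σ = leftOf k σ := List.rdropWhile_append_rtakeWhile ..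
    have h2 : factorγ k σ ++ factorδ k σ = rightOf k σ := List.takeWhile_append_dropWhile
    have h3 : leftOf k σ ++ k :: rightOf k σ = σ := by
      have h4 : σ.dropWhile (fun x => decide (x ≠ k)) ≠ [] := by
        rw [Ne, List.dropWhile_eq_nil_iff]
        intro h
        simpa using h k hk
      have h5 : (σ.dropWhile (fun x => decide (x ≠ k))).head h4 = k := by
        simpa using List.head_dropWhile_not (fun x => decide (x ≠ k)) h4
      have h6 := List.cons_head_tail h4
      rw [h5] at h6
      rw [leftOf, rightOf, h6, List.takeWhile_append_dropWhile]
    conv_rhs => rw [← h3, ← h1, ← h2]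
    rw [List.perm_iff_count]
    intro a
    simp only [List.count_append, List.count_cons, List.count_nil]
    omega
  · exact List.Perm.refl _

theorem perm_of_mem_fsOrbit {σ τ : List ℕ} (h : τ ∈ fsOrbit σ) : τ.Perm σ := by
  induction (show Relation.ReflTransGen _ σ τ from h) with
  | refl => exact List.Perm.refl _
  | tail _ hs ih =>
    obtain ⟨k, -, rfl⟩ := hs
    exact (phi_perm k _).trans (ih ‹_›)

theorem self_mem_fsOrbit (σ : List ℕ) : σ ∈ fsOrbit σ := Relation.ReflTransGen.refl

theorem fsOrbit_trans {σ τ ρ : List ℕ} (h : τ ∈ fsOrbit σ) (h' : ρ ∈ fsOrbit τ) :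
    ρ ∈ fsOrbit σ := Relation.ReflTransGen.trans h h'

theorem phi_mem_fsOrbit {σ τ : List ℕ} (h : τ ∈ fsOrbit σ) {k : ℕ} (hk : k ∈ τ) :
    phi k τ ∈ fsOrbit σ := Relation.ReflTransGen.tail h ⟨k, hk, rfl⟩

@[simp] theorem fsOrbit_nil : fsOrbit [] = {[]} := by
  ext τ
  refine ⟨fun h => ?_, fun h => ?_⟩
  · simpa using perm_of_mem_fsOrbit h
  · rw [Set.mem_singleton_iff.1 h]; exact self_mem_fsOrbit []

/-- The generators permute the subtrees of each vertex of the decreasing tree independently. -/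
theorem mem_fsOrbit_node {β γ : List ℕ} {k : ℕ} (hd : (β ++ k :: γ).Nodup)
    (hβ : ∀ x ∈ β, x < k) (hγ : ∀ x ∈ γ, x < k) {τ : List ℕ} :
    τ ∈ fsOrbit (β ++ k :: γ) ↔ ∃ β' ∈ fsOrbit β, ∃ γ' ∈ fsOrbit γ,
      τ = β' ++ k :: γ' ∨ τ = γ' ++ k :: β' := by
  have hdisj : ∀ x ∈ β, x ∉ γ := fun x hx hx' => by
    have := (List.nodup_append.1 hd).2.2 x hx x (by simp [hx'])
    exact this rfl
  constructor
  · intro h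
    induction (show Relation.ReflTransGen _ _ τ from h) with
    | refl => exact ⟨β, self_mem_fsOrbit β, γ, self_mem_fsOrbit γ, Or.inl rfl⟩
    | tail h1 hs ih =>
      obtain ⟨j, hj, rfl⟩ := hs
      obtain ⟨β', hβ', γ', hγ', hτ⟩ := ih h1
      have pβ := perm_of_mem_fsOrbit hβ'
      have pγ := perm_of_mem_fsOrbit hγ'
      have lβ : ∀ x ∈ β', x < k := fun x hx => hβ x (pβ.mem_iff.1 hx)
      have lγ : ∀ x ∈ γ', x < k := fun x hx => hγ x (pγ.mem_iff.1 hx)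
      rcases hτ with rfl | rfl <;>
      rcases List.mem_append.1 hj with hj | hj
      · exact ⟨_, phi_mem_fsOrbit hβ' hj, γ', hγ',
          Or.inl (phi_append_cons_of_mem_left hj (lβ j hj) γ')⟩
      · rcases List.mem_cons.1 hj with rfl | hj
        · exact ⟨β', hβ', γ', hγ', Or.inr (phi_node lβ lγ)⟩
        · refine ⟨β', hβ', _, phi_mem_fsOrbit hγ' hj,
            Or.inl (phi_append_cons_of_mem_right hj (fun hx => ?_) (lγ j hj))⟩
          exact hdisj j (pβ.mem_iff.1 hx) (pγ.mem_iff.1 hj)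
      · exact ⟨β', hβ', _, phi_mem_fsOrbit hγ' hj,
          Or.inr (phi_append_cons_of_mem_left hj (lγ j hj) β')⟩
      · rcases List.mem_cons.1 hj with rfl | hj
        · exact ⟨β', hβ', γ', hγ', Or.inl (phi_node lγ lβ)⟩
        · refine ⟨_, phi_mem_fsOrbit hβ' hj, γ', hγ',
            Or.inr (phi_append_cons_of_mem_right hj (fun hx => ?_) (lβ j hj))⟩
          exact hdisj j (pβ.mem_iff.1 hj) (pγ.mem_iff.1 hx)
  · rintro ⟨β', hβ', γ', hγ', hτ⟩
    have pβ := perm_of_mem_fsOrbit hβ'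
    have pγ := perm_of_mem_fsOrbit hγ'
    have lβ : ∀ x ∈ β', x < k := fun x hx => hβ x (pβ.mem_iff.1 hx)
    have lγ : ∀ x ∈ γ', x < k := fun x hx => hγ x (pγ.mem_iff.1 hx)
    have h1 : β' ++ k :: γ ∈ fsOrbit (β ++ k :: γ) := by
      clear lβ pβ hτ
      induction (show Relation.ReflTransGen _ _ β' from hβ') with
      | refl => exact self_mem_fsOrbit _
      | @tail b _ h1 hs ih =>
        obtain ⟨j, hj, rfl⟩ := hs
        rw [← phi_append_cons_of_mem_left hj (hβ j ((perm_of_mem_fsOrbit h1).mem_iff.1 hj))]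
        exact phi_mem_fsOrbit (ih h1) (by simp [hj])
    have h2 : β' ++ k :: γ' ∈ fsOrbit (β' ++ k :: γ) := by
      clear lγ pγ hτ h1
      induction (show Relation.ReflTransGen _ _ γ' from hγ') with
      | refl => exact self_mem_fsOrbit _
      | @tail b _ h1 hs ih =>
        obtain ⟨j, hj, rfl⟩ := hs
        have hjγ := (perm_of_mem_fsOrbit h1).mem_iff.1 hj
        rw [← phi_append_cons_of_mem_right hj (fun hx => hdisj j (pβ.mem_iff.1 hx) hjγ) (hγ j hjγ)]
        exact phi_mem_fsOrbit (ih h1) (by simp [hj])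
    have h3 := fsOrbit_trans h1 h2
    rcases hτ with rfl | rfl
    · exact h3
    · rw [← phi_node lβ lγ]
      exact phi_mem_fsOrbit h3 (by simp)

theorem fsOrbit_symm {σ τ : List ℕ} (hσ : σ.Nodup) (h : τ ∈ fsOrbit σ) : σ ∈ fsOrbit τ := by
  induction σ, hσ using nodup_max_induction generalizing τ with
  | nil => simp_all
  | node β k γ hd hβ hγ ihβ ihγ =>
    obtain ⟨β', hβ', γ', hγ', hτ⟩ := (mem_fsOrbit_node hd hβ hγ).1 h
    have pβ := perm_of_mem_fsOrbit hβ'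
    have pγ := perm_of_mem_fsOrbit hγ'
    have lβ : ∀ x ∈ β', x < k := fun x hx => hβ x (pβ.mem_iff.1 hx)
    have lγ : ∀ x ∈ γ', x < k := fun x hx => hγ x (pγ.mem_iff.1 hx)
    have hdτ := (perm_of_mem_fsOrbit h).nodup_iff.2 hd
    rcases hτ with rfl | rfl
    · exact (mem_fsOrbit_node hdτ lβ lγ).2 ⟨β, ihβ hβ', γ, ihγ hγ', Or.inl rfl⟩
    · exact (mem_fsOrbit_node hdτ lγ lβ).2 ⟨γ, ihγ hγ', β, ihβ hβ', Or.inr rfl⟩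

theorem pin_eq_of_mem_fsOrbit {σ τ : List ℕ} (hσ : σ.Nodup) (h : τ ∈ fsOrbit σ) :
    pin τ = pin σ := by
  induction σ, hσ using nodup_max_induction generalizing τ with
  | nil => simp_all
  | node β k γ hd hβ hγ ihβ ihγ =>
    obtain ⟨β', hβ', γ', hγ', hτ⟩ := (mem_fsOrbit_node hd hβ hγ).1 h
    have pβ := perm_of_mem_fsOrbit hβ'
    have pγ := perm_of_mem_fsOrbit hγ'
    have lβ : ∀ x ∈ β', x < k := fun x hx => hβ x (pβ.mem_iff.1 hx)
    have lγ : ∀ x ∈ γ', x < k := fun x hx => hγ x (pγ.mem_iff.1 hx)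
    have nβ : β' = [] ↔ β = [] := by
      rw [← List.length_eq_zero_iff, pβ.length_eq, List.length_eq_zero_iff]
    have nγ : γ' = [] ↔ γ = [] := by
      rw [← List.length_eq_zero_iff, pγ.length_eq, List.length_eq_zero_iff]
    ext b
    rcases hτ with rfl | rfl
    · rw [mem_pin_node lβ lγ, mem_pin_node hβ hγ, ihβ hβ', ihγ hγ', Ne, nβ, Ne, nγ]
    · rw [mem_pin_node lγ lβ, mem_pin_node hβ hγ, ihβ hβ', ihγ hγ', Ne, nγ, Ne, nβ]
      tauto

/-! ### Size of an orbit -/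

theorem fsOrbit_node_eq {β γ : List ℕ} {k : ℕ} (hd : (β ++ k :: γ).Nodup)
    (hβ : ∀ x ∈ β, x < k) (hγ : ∀ x ∈ γ, x < k) :
    fsOrbit (β ++ k :: γ) =
      (fun q : List ℕ × List ℕ => q.1 ++ k :: q.2) '' (fsOrbit β ×ˢ fsOrbit γ) ∪
      (fun q : List ℕ × List ℕ => q.1 ++ k :: q.2) '' (fsOrbit γ ×ˢ fsOrbit β) := by
  ext τ
  rw [mem_fsOrbit_node hd hβ hγ]
  simp only [Set.mem_union, Set.mem_image, Set.mem_prod, Prod.exists]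
  constructor
  · rintro ⟨β', hβ', γ', hγ', rfl | rfl⟩
    exacts [Or.inl ⟨β', γ', ⟨hβ', hγ'⟩, rfl⟩, Or.inr ⟨γ', β', ⟨hγ', hβ'⟩, rfl⟩]
  · rintro (⟨β', γ', ⟨hβ', hγ'⟩, rfl⟩ | ⟨γ', β', ⟨hγ', hβ'⟩, rfl⟩)
    exacts [⟨β', hβ', γ', hγ', Or.inl rfl⟩, ⟨β', hβ', γ', hγ', Or.inr rfl⟩]

theorem fsOrbit_finite {σ : List ℕ} (hσ : σ.Nodup) : (fsOrbit σ).Finite := by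
  induction σ, hσ using nodup_max_induction with
  | nil => simp
  | node β k γ hd hβ hγ ihβ ihγ =>
    rw [fsOrbit_node_eq hd hβ hγ]
    exact ((ihβ.prod ihγ).image _).union ((ihγ.prod ihβ).image _)

theorem ncard_image_node {k : ℕ} {A B : Set (List ℕ)} (hA : ∀ w ∈ A, ∀ x ∈ w, x < k)
    (hB : ∀ w ∈ B, ∀ x ∈ w, x < k) :
    ((fun q : List ℕ × List ℕ => q.1 ++ k :: q.2) '' (A ×ˢ B)).ncard = A.ncard * B.ncard := by
  rw [Set.InjOn.ncard_image, Set.ncard_prod]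
  rintro ⟨a, b⟩ ⟨ha, hb⟩ ⟨a', b'⟩ ⟨ha', hb'⟩ h
  obtain ⟨h1, -, h2⟩ := (node_eq_iff (hA a ha) (hB b hb) (hA a' ha') (hB b' hb')).1 h
  exact Prod.ext h1 h2

/-- The orbit of a nonempty word has `2 ^ d` elements, where `d` is the number of vertices of the
decreasing tree that are not leaves; and there is one more leaf than there are pinnacles, which
are the vertices with two children. -/
theorem ncard_fsOrbit {σ : List ℕ} (hσ : σ.Nodup) (h0 : σ ≠ []) :
    (fsOrbit σ).ncard * 2 ^ ((pin σ).ncard + 1) = 2 ^ σ.length := by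
  induction σ, hσ using nodup_max_induction with
  | nil => simp at h0
  | node β k γ hd hβ hγ ihβ ihγ =>
    have lβ : ∀ w ∈ fsOrbit β, ∀ x ∈ w, x < k := fun w hw x hx =>
      hβ x ((perm_of_mem_fsOrbit hw).mem_iff.1 hx)
    have lγ : ∀ w ∈ fsOrbit γ, ∀ x ∈ w, x < k := fun w hw x hx =>
      hγ x ((perm_of_mem_fsOrbit hw).mem_iff.1 hx)
    have hdisj : ∀ x ∈ β, x ∉ γ := fun x hx hx' =>
      (List.nodup_append.1 hd).2.2 x hx x (by simp [hx']) rfl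
    have ndβ := (List.nodup_append.1 hd).1
    have ndγ := (List.nodup_append.1 hd).2.1.of_cons
    -- unless the root is a leaf, exchanging its subtrees always changes the word
    have hcard : ¬ (β = [] ∧ γ = []) → (fsOrbit (β ++ k :: γ)).ncard =
        2 * ((fsOrbit β).ncard * (fsOrbit γ).ncard) := by
      intro hne
      rw [fsOrbit_node_eq hd hβ hγ, Set.ncard_union_eq ?_
          (((fsOrbit_finite ndβ).prod (fsOrbit_finite ndγ)).image _)
          (((fsOrbit_finite ndγ).prod (fsOrbit_finite ndβ)).image _), ncard_image_node lβ lγ,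
        ncard_image_node lγ lβ]
      · ring
      · rw [Set.disjoint_left]
        rintro _ ⟨⟨a, b⟩, ⟨ha, hb⟩, rfl⟩ ⟨⟨a', b'⟩, ⟨ha', hb'⟩, h⟩
        obtain ⟨rfl, -, rfl⟩ := (node_eq_iff (lγ a' ha') (lβ b' hb') (lβ a ha) (lγ b hb)).1 h
        have e1 := (perm_of_mem_fsOrbit ha).symm.trans (perm_of_mem_fsOrbit ha')
        have hβ0 : β = [] := List.eq_nil_iff_forall_not_mem.2 fun x hx =>
          hdisj x hx (e1.mem_iff.1 hx)
        subst hβ0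
        exact hne ⟨rfl, by simpa using e1⟩
    rcases eq_or_ne β [] with rfl | hβ0 <;> rcases eq_or_ne γ [] with rfl | hγ0
    · rw [fsOrbit_node_eq hd hβ hγ]; simp
    · have hp : pin ([] ++ k :: γ) = pin γ := by
        ext b; rw [mem_pin_node hβ hγ]; simp
      have := ihγ hγ0
      rw [hp, hcard (by simp [hγ0])]
      simp only [fsOrbit_nil, Set.ncard_singleton, List.nil_append, List.length_cons,
        pow_succ (2 : ℕ) γ.length, ← this]
      ring
    · have hp : pin (β ++ [k]) = pin β := by
        ext b; simp [mem_pin_node hβ hγ]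
      have := ihβ hβ0
      rw [hp, hcard (by simp [hβ0])]
      simp only [fsOrbit_nil, Set.ncard_singleton, List.length_append, List.length_singleton,
        pow_succ (2 : ℕ) β.length, ← this]
      ring
    · have hp : pin (β ++ k :: γ) = insert k (pin β ∪ pin γ) := by
        ext b; simp [mem_pin_node hβ hγ, hβ0, hγ0]; tauto
      have hk : k ∉ pin β ∪ pin γ := by
        rintro (h | h)
        exacts [(hβ k (mem_of_mem_pin h)).ne rfl, (hγ k (mem_of_mem_pin h)).ne rfl]
      have hc : (pin (β ++ k :: γ)).ncard = (pin β).ncard + (pin γ).ncard + 1 := by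
        rw [hp, Set.ncard_insert_of_notMem hk ((pin_finite β).union (pin_finite γ)),
          Set.ncard_union_eq _ (pin_finite β) (pin_finite γ)]
        exact Set.disjoint_left.2 fun x h h' => hdisj x (mem_of_mem_pin h) (mem_of_mem_pin h')
      rw [hc, hcard (by simp [hβ0])]
      have e1 := ihβ hβ0
      have e2 := ihγ hγ0
      rw [List.length_append, List.length_cons, pow_add 2 β.length, pow_succ 2 γ.length, ← e1, ← e2]
      ring

/-! ### Lexicographically smallest words -/

/-- The first letter of `β` is smaller than all letters of `γ`; in particular `γ` is empty
if `β` is. -/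
def HeadLt (β γ : List ℕ) : Prop := ∀ x ∈ γ, ∃ b ∈ β.head?, b < x

@[simp] theorem headLt_nil_right (β : List ℕ) : HeadLt β [] := by simp [HeadLt]

@[simp] theorem headLt_nil_left {γ : List ℕ} : HeadLt [] γ ↔ γ = [] := by
  simp [HeadLt, List.eq_nil_iff_forall_not_mem]

@[simp] theorem headLt_cons {b : ℕ} {l γ : List ℕ} : HeadLt (b :: l) γ ↔ ∀ x ∈ γ, b < x := by
  simp [HeadLt]

/-- A canonical word: at each vertex of its decreasing tree, the left subtree is
nonempty unless the vertex is a leaf, and the word of the left subtree starts with a letter that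
is smaller than all letters of the right subtree. -/
inductive Canon : List ℕ → Prop
  | nil : Canon []
  | node (β : List ℕ) (k : ℕ) (γ : List ℕ) (hβ : ∀ x ∈ β, x < k) (hγ : ∀ x ∈ γ, x < k)
      (cβ : Canon β) (cγ : Canon γ) (h : HeadLt β γ) : Canon (β ++ k :: γ)

theorem canon_node_iff {β γ : List ℕ} {k : ℕ} (hβ : ∀ x ∈ β, x < k) (hγ : ∀ x ∈ γ, x < k) :
    Canon (β ++ k :: γ) ↔ Canon β ∧ Canon γ ∧ HeadLt β γ := by
  constructor
  · intro h
    generalize hσ : β ++ k :: γ = σ at h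
    cases h with
    | nil => simp at hσ
    | node β' k' γ' hβ' hγ' cβ cγ h =>
      obtain ⟨rfl, rfl, rfl⟩ := (node_eq_iff hβ hγ hβ' hγ').1 hσ
      exact ⟨cβ, cγ, h⟩
  · rintro ⟨cβ, cγ, h⟩
    exact Canon.node β k γ hβ hγ cβ cγ h

theorem canon_singleton (k : ℕ) : Canon [k] :=
  Canon.node [] k [] (by simp) (by simp) Canon.nil Canon.nil (by simp)

theorem canon_concat_iff {β : List ℕ} {k : ℕ} (hβ : ∀ x ∈ β, x < k) :
    Canon (β ++ [k]) ↔ Canon β := by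
  simp [canon_node_iff hβ (γ := []) (by simp), Canon.nil]

/-- A canonical word starts with its smallest letter. -/
theorem Canon.head_le {σ : List ℕ} (h : Canon σ) :
    ∀ {b : ℕ} {l : List ℕ}, σ = b :: l → ∀ x ∈ σ, b ≤ x := by
  induction h with
  | nil => simp
  | node β k γ hβ hγ cβ cγ h ihβ ihγ =>
    intro b l hl x hx
    cases β with
    | nil =>
      have hγ0 := headLt_nil_left.1 h
      subst hγ0
      simp_all
    | cons b' l' =>
      obtain rfl : b' = b := by simpa using (List.cons.inj hl).1
      have h := headLt_cons.1 h
      rcases List.mem_append.1 hx with hx | hx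
      · exact ihβ rfl x hx
      · rcases List.mem_cons.1 hx with rfl | hx
        · exact (hβ b' (by simp)).le
        · exact (h x hx).le

theorem cons_le_cons_iff {a b : ℕ} {x y : List ℕ} :
    a :: x ≤ b :: y ↔ a < b ∨ a = b ∧ x ≤ y := by
  rw [← not_lt, List.cons_lt_cons_iff, ← not_lt (a := y)]
  rcases lt_trichotomy a b with h | rfl | h
  · simp [h, h.not_gt, h.ne']
  · simp
  · simp [h, h.not_gt, h.ne']

theorem append_le_append_iff_of_length_eq {a b x y : List ℕ} (h : a.length = b.length) :
    a ++ x ≤ b ++ y ↔ a < b ∨ (a = b ∧ x ≤ y) := by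
  induction a generalizing b with
  | nil =>
    obtain rfl : b = [] := by simpa using h.symm
    simp
  | cons c a ih =>
    cases b with
    | nil => simp at h
    | cons d b =>
      have ih := ih (b := b) (by simpa using h)
      rw [List.cons_append, List.cons_append]
      rw [cons_le_cons_iff, List.cons_lt_cons_iff, ih, List.cons.injEq]
      tauto

/-- The canonical words are the smallest elements of their orbits: each vertex of the decreasing
tree sends the subtree with the smaller first letter to the left. -/
theorem isLeast_fsOrbit_iff {σ : List ℕ} (hσ : σ.Nodup) :
    IsLeast (fsOrbit σ) σ ↔ Canon σ := by
  induction σ, hσ using nodup_max_induction with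
  | nil => simp [Canon.nil]
  | node β k γ hd hβ hγ ihβ ihγ =>
    rw [canon_node_iff hβ hγ, ← ihβ, ← ihγ]
    constructor
    · rintro ⟨-, h⟩
      have hle : ∀ β' ∈ fsOrbit β, ∀ γ' ∈ fsOrbit γ, β ++ k :: γ ≤ β' ++ k :: γ' :=
        fun β' hβ' γ' hγ' => h ((mem_fsOrbit_node hd hβ hγ).2 ⟨β', hβ', γ', hγ', Or.inl rfl⟩)
      have lγ : IsLeast (fsOrbit γ) γ := by
        refine ⟨self_mem_fsOrbit γ, fun γ' hγ' => ?_⟩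
        have := hle β (self_mem_fsOrbit β) γ' hγ'
        rw [append_le_append_iff_of_length_eq rfl, cons_le_cons_iff] at this
        simpa using this
      refine ⟨⟨self_mem_fsOrbit β, fun β' hβ' => ?_⟩, lγ, fun x hx => ?_⟩
      · have := hle β' hβ' γ (self_mem_fsOrbit γ)
        rw [append_le_append_iff_of_length_eq (perm_of_mem_fsOrbit hβ').length_eq.symm] at this
        rcases this with h | h
        exacts [h.le, h.1.le]
      · have h1 : β ++ k :: γ ≤ γ ++ k :: β := h ((mem_fsOrbit_node hd hβ hγ).2
          ⟨β, self_mem_fsOrbit β, γ, self_mem_fsOrbit γ, Or.inr rfl⟩)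
        obtain ⟨g, γ, rfl⟩ := List.exists_cons_of_ne_nil (List.ne_nil_of_mem hx)
        have hgx := (ihγ.1 lγ).head_le rfl x hx
        have hgk := hγ g (by simp)
        cases β with
        | nil =>
          rw [List.nil_append, List.cons_append, cons_le_cons_iff] at h1
          omega
        | cons b l =>
          rw [List.cons_append, List.cons_append, cons_le_cons_iff] at h1
          have hbg : b ≠ g := (List.nodup_append.1 hd).2.2 b (by simp) g (by simp)
          exact ⟨b, rfl, by omega⟩
    · rintro ⟨lβ, lγ, hH⟩
      refine ⟨self_mem_fsOrbit _, fun τ hτ => ?_⟩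
      obtain ⟨β', hβ', γ', hγ', rfl | rfl⟩ := (mem_fsOrbit_node hd hβ hγ).1 hτ
      · rw [append_le_append_iff_of_length_eq (perm_of_mem_fsOrbit hβ').length_eq.symm,
          cons_le_cons_iff]
        rcases (lβ.2 hβ').lt_or_eq with h | h
        exacts [Or.inl h, Or.inr ⟨h, Or.inr ⟨rfl, lγ.2 hγ'⟩⟩]
      · have pβ := perm_of_mem_fsOrbit hβ'
        have pγ := perm_of_mem_fsOrbit hγ'
        cases β with
        | nil =>
          obtain rfl := headLt_nil_left.1 hH
          obtain rfl : β' = [] := by simpa using pβ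
          obtain rfl : γ' = [] := by simpa using pγ
          exact le_rfl
        | cons b l =>
          have hb := headLt_cons.1 hH
          cases γ' with
          | nil =>
            rw [List.nil_append, List.cons_append, cons_le_cons_iff]
            exact Or.inl (hβ b (by simp))
          | cons g γ' =>
            rw [List.cons_append, List.cons_append, cons_le_cons_iff]
            exact Or.inl (hb g (pγ.mem_iff.1 (by simp)))

/-! ### Counting -/

theorem permsWithPin_finite (n : ℕ) (S : Finset ℕ) : (permsWithPin n S).Finite := by
  refine (List.finite_toSet (List.range' 1 n).permutations).subset ?_
  rintro σ ⟨h, -⟩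
  exact List.mem_permutations.2 h

theorem fsOrbit_subset_permsWithPin {n : ℕ} {S : Finset ℕ} {σ : List ℕ}
    (hσ : σ ∈ permsWithPin n S) : fsOrbit σ ⊆ permsWithPin n S := fun _ hτ =>
  ⟨(perm_of_mem_fsOrbit hτ).trans hσ.1,
    (pin_eq_of_mem_fsOrbit (mem_permWords.1 hσ.1).1 hτ).trans hσ.2⟩

theorem ncard_fsOrbit_of_mem_permsWithPin {n : ℕ} (hn : 1 ≤ n) {S : Finset ℕ} {σ : List ℕ}
    (hσ : σ ∈ permsWithPin n S) : (fsOrbit σ).ncard = 2 ^ (n - 1 - S.card) := by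
  have hd := (mem_permWords.1 hσ.1).1
  have hl : σ.length = n := by simpa using (show σ.Perm _ from hσ.1).length_eq
  have h := ncard_fsOrbit hd (by rintro rfl; simp at hl; omega)
  rw [hσ.2, Set.ncard_coe_finset, hl] at h
  have h0 : 0 < (fsOrbit σ).ncard :=
    (Set.ncard_pos (fsOrbit_finite hd)).2 ⟨σ, self_mem_fsOrbit σ⟩
  have hle : S.card + 1 ≤ n := by
    refine (Nat.pow_le_pow_iff_right (a := 2) (by norm_num)).1 ?_
    rw [← h]
    exact Nat.le_mul_of_pos_left _ h0
  refine Nat.eq_of_mul_eq_mul_right (pow_pos (two_pos) (S.card + 1)) ?_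
  rw [h, ← pow_add]
  congr 1
  omega

/-- Each orbit has exactly one smallest element, so the smallest elements count the orbits, all of
which have the same size. -/
theorem ncard_isLeast_mul {n : ℕ} (hn : 1 ≤ n) (S : Finset ℕ) :
    {σ | σ ∈ permsWithPin n S ∧ IsLeast (fsOrbit σ) σ}.ncard * 2 ^ (n - 1 - S.card) =
      p n S := by
  set M := {σ | σ ∈ permsWithPin n S ∧ IsLeast (fsOrbit σ) σ} with hM
  have hMf : M.Finite := (permsWithPin_finite n S).subset fun σ h => h.1
  have nd : ∀ σ ∈ permsWithPin n S, σ.Nodup := fun σ h => (mem_permWords.1 h.1).1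
  have hU : permsWithPin n S = ⋃ σ ∈ M, fsOrbit σ := by
    ext τ
    simp only [Set.mem_iUnion, exists_prop]
    constructor
    · intro hτ
      obtain ⟨σ, hσ, hmin⟩ := Set.exists_min_image (fsOrbit τ) id (fsOrbit_finite (nd τ hτ))
        ⟨τ, self_mem_fsOrbit τ⟩
      refine ⟨σ, ⟨fsOrbit_subset_permsWithPin hτ hσ, self_mem_fsOrbit σ, fun ρ hρ => ?_⟩,
        fsOrbit_symm (nd τ hτ) hσ⟩
      exact hmin ρ (fsOrbit_trans hσ hρ)
    · rintro ⟨σ, hσ, hτ⟩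
      exact fsOrbit_subset_permsWithPin hσ.1 hτ
  have hdisj : M.PairwiseDisjoint fsOrbit := by
    intro σ hσ τ hτ hne
    refine Set.disjoint_left.2 fun ρ h1 h2 => hne (le_antisymm ?_ ?_)
    · exact hσ.2.2 (fsOrbit_trans h1 (fsOrbit_symm (nd τ hτ.1) h2))
    · exact hτ.2.2 (fsOrbit_trans h2 (fsOrbit_symm (nd σ hσ.1) h1))
  rw [p, hU, hMf.ncard_biUnion (fun σ hσ => fsOrbit_finite (nd σ hσ.1)) hdisj,
    finsum_mem_congr rfl fun σ hσ => ncard_fsOrbit_of_mem_permsWithPin hn hσ.1,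
    finsum_mem_eq_finite_toFinset_sum _ hMf, Finset.sum_const, smul_eq_mul,
    Set.ncard_eq_toFinset_card M hMf]

/-! ### Order-preserving relabelling -/

theorem HeadLt.map {f : ℕ → ℕ} {β γ : List ℕ} (h : HeadLt β γ)
    (hf : ∀ b ∈ β.head?, ∀ x ∈ γ, b < x → f b < f x) : HeadLt (β.map f) (γ.map f) := by
  intro y hy
  obtain ⟨x, hx, rfl⟩ := List.mem_map.1 hy
  obtain ⟨b, hb, hbx⟩ := h x hx
  exact ⟨f b, by simpa using ⟨b, hb, rfl⟩, hf b hb x hx hbx⟩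

theorem headLt_map_iff {f : ℕ → ℕ} {β γ : List ℕ}
    (hf : StrictMonoOn f {x | x ∈ β ∨ x ∈ γ}) :
    HeadLt (β.map f) (γ.map f) ↔ HeadLt β γ := by
  constructor
  · intro h x hx
    obtain ⟨y, hy, hyx⟩ := h (f x) (List.mem_map_of_mem hx)
    rw [List.head?_map] at hy
    obtain ⟨b, hb, rfl⟩ := Option.mem_map.1 hy
    exact ⟨b, hb, (hf.lt_iff_lt (Or.inl (List.mem_of_mem_head? hb)) (Or.inr hx)).1 hyx⟩
  · intro h
    exact h.map fun b hb x hx hbx => hf (Or.inl (List.mem_of_mem_head? hb)) (Or.inr hx) hbx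

theorem canon_map_iff_and_pin_map {f : ℕ → ℕ} {σ : List ℕ} (hσ : σ.Nodup)
    (hf : StrictMonoOn f {x | x ∈ σ}) :
    (Canon (σ.map f) ↔ Canon σ) ∧ pin (σ.map f) = f '' pin σ := by
  induction σ, hσ using nodup_max_induction with
  | nil => simp
  | node β k γ hd hβ hγ ihβ ihγ =>
    have ihβ := ihβ (hf.mono fun x hx => by simp_all)
    have ihγ := ihγ (hf.mono fun x hx => by simp_all)
    have lβ : ∀ x ∈ β.map f, x < f k := by
      intro y hy
      obtain ⟨x, hx, rfl⟩ := List.mem_map.1 hy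
      exact hf (by simp [hx]) (by simp) (hβ x hx)
    have lγ : ∀ x ∈ γ.map f, x < f k := by
      intro y hy
      obtain ⟨x, hx, rfl⟩ := List.mem_map.1 hy
      exact hf (by simp [hx]) (by simp) (hγ x hx)
    rw [List.map_append, List.map_cons]
    constructor
    · rw [canon_node_iff lβ lγ, canon_node_iff hβ hγ, ihβ.1, ihγ.1, headLt_map_iff]
      exact hf.mono fun x hx => by
        rcases hx with hx | hx <;> simp [hx]
    · ext b
      simp only [mem_pin_node lβ lγ, ihβ.2, ihγ.2, Set.mem_image, mem_pin_node hβ hγ, ne_eq,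
        List.map_eq_nil_iff]
      constructor
      · rintro (⟨x, hx, rfl⟩ | ⟨x, hx, rfl⟩ | ⟨rfl, h⟩)
        exacts [⟨x, Or.inl hx, rfl⟩, ⟨x, Or.inr (Or.inl hx), rfl⟩,
          ⟨k, Or.inr (Or.inr ⟨rfl, h⟩), rfl⟩]
      · rintro ⟨x, hx | hx | ⟨rfl, h⟩, rfl⟩
        exacts [Or.inl ⟨x, hx, rfl⟩, Or.inr (Or.inl ⟨x, hx, rfl⟩), Or.inr (Or.inr ⟨rfl, h⟩)]

/-! ### Exchanging two consecutive values -/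

theorem swap_strictMonoOn {t : ℕ} {σ : List ℕ} (h : t ∉ σ ∨ t + 1 ∉ σ) :
    StrictMonoOn (Equiv.swap t (t + 1)) {x | x ∈ σ} := by
  intro x hx y hy hxy
  have hx : x ∈ σ := hx
  have hy : y ∈ σ := hy
  have : ¬ (x = t ∧ y = t + 1) := by rintro ⟨rfl, rfl⟩; tauto
  simp only [Equiv.swap_apply_def]
  split_ifs <;> omega

theorem mem_swap_image {t b : ℕ} {A : Set ℕ} :
    b ∈ Equiv.swap t (t + 1) '' A ↔ Equiv.swap t (t + 1) b ∈ A := by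
  rw [Set.mem_image_equiv, Equiv.symm_swap]

theorem swap_eq_self_of_lt {t x : ℕ} (h : x < t) : Equiv.swap t (t + 1) x = x :=
  Equiv.swap_apply_of_ne_of_ne (by omega) (by omega)

theorem swap_eq_self_of_gt {t x : ℕ} (h : t + 1 < x) : Equiv.swap t (t + 1) x = x :=
  Equiv.swap_apply_of_ne_of_ne (by omega) (by omega)

theorem map_swap_of_lt {t : ℕ} {σ : List ℕ} (h : ∀ x ∈ σ, x < t) :
    σ.map (Equiv.swap t (t + 1)) = σ := by
  rw [List.map_congr_left fun x hx => swap_eq_self_of_lt (h x hx)]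
  simp

theorem swap_mem_pin_of_lt {t b : ℕ} {σ : List ℕ} (h : ∀ x ∈ σ, x < t) :
    Equiv.swap t (t + 1) b ∈ pin σ ↔ b ∈ pin σ := by
  have ht : t ∉ pin σ := fun h' => (h t (mem_of_mem_pin h')).ne rfl
  have ht1 : t + 1 ∉ pin σ := fun h' => absurd (h _ (mem_of_mem_pin h')) (by omega)
  rw [Equiv.swap_apply_def]
  split_ifs with h1 h2
  · subst h1; simp [ht, ht1]
  · subst h2; simp [ht, ht1]
  · rfl

theorem map_swap_of_notMem {t : ℕ} {σ : List ℕ} (hσ : σ.Nodup) (h : t ∉ σ ∨ t + 1 ∉ σ)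
    (hc : Canon σ) : Canon (σ.map (Equiv.swap t (t + 1))) ∧
      ∀ b, b ∈ pin (σ.map (Equiv.swap t (t + 1))) ↔ Equiv.swap t (t + 1) b ∈ pin σ := by
  obtain ⟨h1, h2⟩ := canon_map_iff_and_pin_map hσ (swap_strictMonoOn h)
  refine ⟨h1.2 hc, fun b => ?_⟩
  rw [h2, mem_swap_image]

/-- Exchanging `t` and `t + 1` below a root `k > t + 1` can be done in the two subtrees. The only
comparison it may disturb is the one between a first letter `t` on the left and a letter `t + 1`
on the right. -/
theorem map_swap_node {t k : ℕ} {β γ : List ℕ} (hk : t + 1 < k) (hβ : ∀ x ∈ β, x < k)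
    (hγ : ∀ x ∈ γ, x < k) (hH : HeadLt β γ) (hex : t ∈ β.head? → t + 1 ∉ γ)
    (ihβ : Canon (β.map (Equiv.swap t (t + 1))) ∧
      ∀ b, b ∈ pin (β.map (Equiv.swap t (t + 1))) ↔ Equiv.swap t (t + 1) b ∈ pin β)
    (ihγ : Canon (γ.map (Equiv.swap t (t + 1))) ∧
      ∀ b, b ∈ pin (γ.map (Equiv.swap t (t + 1))) ↔ Equiv.swap t (t + 1) b ∈ pin γ) :
    Canon ((β ++ k :: γ).map (Equiv.swap t (t + 1))) ∧
      ∀ b, b ∈ pin ((β ++ k :: γ).map (Equiv.swap t (t + 1))) ↔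
        Equiv.swap t (t + 1) b ∈ pin (β ++ k :: γ) := by
  have hl : ∀ w : List ℕ, (∀ x ∈ w, x < k) → ∀ x ∈ w.map (Equiv.swap t (t + 1)), x < k := by
    intro w hw y hy
    obtain ⟨x, hx, rfl⟩ := List.mem_map.1 hy
    have := hw x hx
    rw [Equiv.swap_apply_def]
    split_ifs <;> omega
  rw [List.map_append, List.map_cons, swap_eq_self_of_gt hk]
  constructor
  · rw [canon_node_iff (hl β hβ) (hl γ hγ)]
    refine ⟨ihβ.1, ihγ.1, hH.map fun b hb x hx hbx => ?_⟩
    have : ¬ (b = t ∧ x = t + 1) := by rintro ⟨rfl, rfl⟩; exact hex hb hx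
    simp only [Equiv.swap_apply_def]
    split_ifs <;> omega
  · intro b
    have hb : Equiv.swap t (t + 1) b = k ↔ b = k := by
      rw [Equiv.swap_apply_eq_iff, swap_eq_self_of_gt hk]
    rw [mem_pin_node (hl β hβ) (hl γ hγ), mem_pin_node hβ hγ, ihβ.2, ihγ.2, hb]
    simp

theorem lt_of_split {t : ℕ} {β γ : List ℕ} (hd : (β ++ t :: γ).Nodup)
    (h : ∀ x ∈ β ++ t :: γ, x < t + 1) : (∀ x ∈ β, x < t) ∧ ∀ x ∈ γ, x < t := by
  simp only [List.nodup_append, List.nodup_cons] at hd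
  refine ⟨fun x hx => ?_, fun x hx => ?_⟩
  · have := h x (by simp [hx])
    have := hd.2.2 x hx t (by simp)
    omega
  · have := h x (by simp [hx])
    have : x ≠ t := by rintro rfl; exact hd.2.1.1 hx
    omega

/-- If `t` is a pinnacle and `t + 1` is not, the two values can be exchanged: an only child `t` of
`t + 1` hands its left subtree to `t + 1` and becomes the right child. -/
theorem map_swap_of_mem_pin {t : ℕ} {σ : List ℕ} (hσ : σ.Nodup) (hc : Canon σ)
    (ht : t ∈ σ → t ∈ pin σ) (ht1 : t + 1 ∉ pin σ) :
    Canon (σ.map (Equiv.swap t (t + 1))) ∧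
      ∀ b, b ∈ pin (σ.map (Equiv.swap t (t + 1))) ↔ Equiv.swap t (t + 1) b ∈ pin σ := by
  induction σ, hσ using nodup_max_induction with
  | nil => simp [Canon.nil]
  | node β k γ hd hβ hγ ihβ ihγ =>
    by_cases hboth : t ∉ β ++ k :: γ ∨ t + 1 ∉ β ++ k :: γ
    · exact map_swap_of_notMem hd hboth hc
    push Not at hboth
    obtain ⟨cβ, cγ, hH⟩ := (canon_node_iff hβ hγ).1 hc
    have ndβ := (List.nodup_append.1 hd).1
    have ndγ := (List.nodup_append.1 hd).2.1.of_cons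
    have hdisj : ∀ x ∈ β, x ∉ γ := fun x hx hx' =>
      (List.nodup_append.1 hd).2.2 x hx x (by simp [hx']) rfl
    have hmem := hboth.2
    have htp := (mem_pin_node hβ hγ).1 (ht hboth.1)
    rw [mem_pin_node hβ hγ] at ht1
    push Not at ht1
    have hk : t + 1 ≤ k := by
      rcases List.mem_append.1 hmem with h | h
      · exact (hβ _ h).le
      · rcases List.mem_cons.1 h with h | h
        exacts [h.le, (hγ _ h).le]
    rcases hk.eq_or_lt with rfl | hk
    · -- the root `t + 1` has one child; `t`, which has two, lies below it
      have hγ0 : γ = [] := by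
        by_contra h
        refine h (ht1.2.2 rfl fun hβ0 => ?_)
        subst hβ0
        exact h (headLt_nil_left.1 hH)
      subst hγ0
      have htβ : t ∈ pin β := by
        rcases htp with h | h | h
        · exact h
        · simp at h
        · omega
      obtain ⟨β, γ, rfl⟩ := List.append_of_mem (mem_of_mem_pin htβ)
      obtain ⟨lβ, lγ⟩ := lt_of_split ndβ hβ
      have lγ' : ∀ x ∈ γ ++ [t], x < t + 1 := by
        intro x hx
        rcases List.mem_append.1 hx with hx | hx
        · have := lγ x hx; omega
        · simp_all
      have lβ' : ∀ x ∈ β, x < t + 1 := fun x hx => (lβ x hx).trans (by omega)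
      have htt : β ≠ [] ∧ γ ≠ [] := by
        rcases (mem_pin_node lβ lγ).1 htβ with h | h | h
        · exact absurd (lβ t (mem_of_mem_pin h)) (by omega)
        · exact absurd (lγ t (mem_of_mem_pin h)) (by omega)
        · exact h.2
      have e : (β ++ t :: γ ++ [t + 1]).map (Equiv.swap t (t + 1)) = β ++ (t + 1) :: (γ ++ [t]) := by
        simp [map_swap_of_lt lβ, map_swap_of_lt lγ]
      rw [e]
      obtain ⟨c1, c2, h3⟩ := (canon_node_iff lβ lγ).1 cβ
      constructor
      · rw [canon_node_iff lβ' lγ', canon_concat_iff lγ]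
        refine ⟨c1, c2, ?_⟩
        obtain ⟨b, l, rfl⟩ := List.exists_cons_of_ne_nil htt.1
        rw [headLt_cons] at h3 ⊢
        intro x hx
        rcases List.mem_append.1 hx with hx | hx
        · exact h3 x hx
        · rw [List.mem_singleton.1 hx]; exact lβ b (by simp)
      · intro b
        rw [mem_pin_node lβ' lγ', mem_pin_node lγ (by simp), mem_pin_node hβ hγ,
          mem_pin_node lβ lγ, swap_mem_pin_of_lt lβ, swap_mem_pin_of_lt lγ]
        have : Equiv.swap t (t + 1) b = t ↔ b = t + 1 := by
          rw [Equiv.swap_apply_eq_iff, Equiv.swap_apply_left]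
        simp [this, htt]
    · have hkt : t ≠ k := by omega
      refine map_swap_node hk hβ hγ hH (fun h _ => ?_) (ihβ cβ (fun h => ?_) ht1.1)
        (ihγ cγ (fun h => ?_) ht1.2.1)
      · -- the first letter of `β` is not a pinnacle
        obtain ⟨l, rfl⟩ : ∃ l, β = t :: l := by
          cases β with
          | nil => simp at h
          | cons b l => exact ⟨l, by simp at h; rw [h]⟩
        rcases htp with h | h | h
        exacts [head_notMem_pin ndβ h, hdisj t (by simp) (mem_of_mem_pin h), hkt h.1]
      · rcases htp with h' | h' | h'
        exacts [h', absurd (mem_of_mem_pin h') (hdisj t h), absurd h'.1 hkt]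
      · rcases htp with h' | h' | h'
        exacts [absurd h (hdisj t (mem_of_mem_pin h')), h', absurd h'.1 hkt]

/-- If `t + 1` is a pinnacle and `t` is not, the two values can be exchanged unless `t` is the left
child of `t + 1` (excluded by `hA`) or a leaf that is its right child (excluded by `hB`). The
remaining possibility for a child, a right child `t` with one subtree, becomes after the exchange
the left child of `t + 1`, with two subtrees. -/
theorem map_swap_of_succ_mem_pin {t : ℕ} {σ : List ℕ} (hσ : σ.Nodup) (hc : Canon σ)
    (ht1 : t + 1 ∈ σ → t + 1 ∈ pin σ) (ht : t ∉ pin σ)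
    (hA : ∀ u v, σ ≠ u ++ t :: (t + 1) :: v)
    (hB : ∀ u v, σ = u ++ (t + 1) :: t :: v → ¬ ∀ c ∈ v.head?, t + 1 < c) :
    Canon (σ.map (Equiv.swap t (t + 1))) ∧
      ∀ b, b ∈ pin (σ.map (Equiv.swap t (t + 1))) ↔ Equiv.swap t (t + 1) b ∈ pin σ := by
  induction σ, hσ using nodup_max_induction with
  | nil => simp [Canon.nil]
  | node β k γ hd hβ hγ ihβ ihγ =>
    by_cases hboth : t ∉ β ++ k :: γ ∨ t + 1 ∉ β ++ k :: γ
    · exact map_swap_of_notMem hd hboth hc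
    push Not at hboth
    obtain ⟨cβ, cγ, hH⟩ := (canon_node_iff hβ hγ).1 hc
    have ndβ := (List.nodup_append.1 hd).1
    have ndγ := (List.nodup_append.1 hd).2.1.of_cons
    have hdisj : ∀ x ∈ β, x ∉ γ := fun x hx hx' =>
      (List.nodup_append.1 hd).2.2 x hx x (by simp [hx']) rfl
    have hmem := hboth.2
    have htp := (mem_pin_node hβ hγ).1 (ht1 hboth.2)
    rw [mem_pin_node hβ hγ] at ht
    push Not at ht
    have hk : t + 1 ≤ k := by
      rcases List.mem_append.1 hmem with h | h
      · exact (hβ _ h).le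
      · rcases List.mem_cons.1 h with h | h
        exacts [h.le, (hγ _ h).le]
    rcases hk.eq_or_lt with rfl | hk
    · -- the root is `t + 1`, and the exceptions leave for `t` only the right child with one subtree
      have h0 : β ≠ [] ∧ γ ≠ [] := by
        rcases htp with h | h | h
        · exact absurd (hβ _ (mem_of_mem_pin h)) (by omega)
        · exact absurd (hγ _ (mem_of_mem_pin h)) (by omega)
        · exact h.2
      -- the vertex `t` has no right child
      have hleaf : ∀ β₁ γ₁ : List ℕ, (∀ x ∈ β₁, x < t) → (∀ x ∈ γ₁, x < t) →
          Canon (β₁ ++ t :: γ₁) → t ∉ pin (β₁ ++ t :: γ₁) → γ₁ = [] := by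
        intro β₁ γ₁ l1 l2 c hp
        by_contra h
        refine hp ((mem_pin_node l1 l2).2 (Or.inr (Or.inr ⟨rfl, ?_, h⟩)))
        rintro rfl
        exact h (headLt_nil_left.1 ((canon_node_iff l1 l2).1 c).2.2)
      have hor : t ∈ β ∨ t ∈ γ := by
        have := hboth.1
        simp only [List.mem_append, List.mem_cons] at this
        rcases this with h | h | h
        exacts [Or.inl h, absurd h (by omega), Or.inr h]
      rcases hor with h | h
      · obtain ⟨β₁, γ₁, rfl⟩ := List.append_of_mem h
        obtain ⟨l1, l2⟩ := lt_of_split ndβ hβ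
        obtain rfl := hleaf β₁ γ₁ l1 l2 cβ ht.1
        exact absurd (by simp) (hA β₁ γ)
      · obtain ⟨β₁, γ₁, rfl⟩ := List.append_of_mem h
        obtain ⟨l1, l2⟩ := lt_of_split ndγ hγ
        obtain rfl := hleaf β₁ γ₁ l1 l2 cγ ht.2.1
        have hβ₁ : β₁ ≠ [] := by
          rintro rfl
          exact hB β [] rfl (by simp)
        have lβ : ∀ x ∈ β, x < t := by
          intro x hx
          have := hβ x hx
          have : x ≠ t := by rintro rfl; exact hdisj x hx h
          omega
        have e : (β ++ (t + 1) :: (β₁ ++ [t])).map (Equiv.swap t (t + 1)) =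
            (β ++ t :: β₁) ++ [t + 1] := by
          simp [map_swap_of_lt lβ, map_swap_of_lt l1]
        have l' : ∀ x ∈ β ++ t :: β₁, x < t + 1 := by
          intro x hx
          simp only [List.mem_append, List.mem_cons] at hx
          rcases hx with hx | rfl | hx
          · exact hβ x hx
          · omega
          · exact (l1 x hx).trans (by omega)
        rw [e]
        constructor
        · rw [canon_concat_iff l', canon_node_iff lβ l1]
          refine ⟨cβ, (canon_concat_iff l1).1 cγ, fun x hx => hH x (by simp [hx])⟩
        · intro b
          rw [mem_pin_node l' (by simp), mem_pin_node lβ l1, mem_pin_node hβ hγ,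
            mem_pin_node l1 (by simp), swap_mem_pin_of_lt lβ, swap_mem_pin_of_lt l1]
          have : Equiv.swap t (t + 1) b = t + 1 ↔ b = t := by
            rw [Equiv.swap_apply_eq_iff, Equiv.swap_apply_right]
          simp [this, h0.1, hβ₁]
    · have hkt : t + 1 ≠ k := by omega
      refine map_swap_node hk hβ hγ hH (fun h h1 => ?_)
        (ihβ cβ (fun h => ?_) ht.1 (fun u v h => ?_) (fun u v h h' => ?_))
        (ihγ cγ (fun h => ?_) ht.2.1 (fun u v h => ?_) (fun u v h h' => ?_))
      · -- a neighbour of the pinnacle `t + 1` would be at most `t`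
        have h1p : t + 1 ∈ pin γ := by
          rcases htp with h' | h' | h'
          exacts [absurd h1 (hdisj _ (mem_of_mem_pin h')), h', absurd h'.1 hkt]
        obtain ⟨a, ha, hat⟩ := exists_lt_of_mem_pin h1p
        obtain ⟨b, hb, hba⟩ := hH a ha
        obtain rfl : b = t := Option.mem_unique hb h
        omega
      · rcases htp with h' | h' | h'
        exacts [h', absurd (mem_of_mem_pin h') (hdisj _ h), absurd h'.1 hkt]
      · exact hA u (v ++ k :: γ) (by simp [h])
      · refine hB u (v ++ k :: γ) (by simp [h]) ?_
        cases v with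
        | nil => simpa using hk
        | cons c v => simpa using h'
      · rcases htp with h' | h' | h'
        exacts [absurd h (hdisj _ (mem_of_mem_pin h')), h', absurd h'.1 hkt]
      · exact hA (β ++ k :: u) v (by simp [h])
      · exact hB (β ++ k :: u) v (by simp [h]) h'

/-! ### Inserting two letters -/

/-- The inserted letters form a vertex `t + 1` whose right subtree is the leaf `t`. -/
theorem canon_insert_iff {t : ℕ} {w : List ℕ} (hw : w.Nodup) (ht : t ∉ w) (ht1 : t + 1 ∉ w)
    {u v : List ℕ} (huv : w = u ++ v) (hu : ∃ a ∈ u.getLast?, a < t)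
    (hv : ∀ c ∈ v.head?, t + 1 < c) :
    Canon (u ++ (t + 1) :: t :: v) ↔ Canon w := by
  induction w, hw using nodup_max_induction generalizing u v with
  | nil =>
    obtain ⟨rfl, rfl⟩ : u = [] ∧ v = [] := by simpa using huv
    simp at hu
  | node β k γ hd hβ hγ ihβ ihγ =>
    have htk : k ≠ t := by rintro rfl; simp at ht
    have htk1 : k ≠ t + 1 := by rintro rfl; simp at ht1
    have hmax : ∀ x ∈ u ++ v, x ≤ k := by
      intro x hx
      rw [← huv] at hx
      simp only [List.mem_append, List.mem_cons] at hx
      rcases hx with hx | rfl | hx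
      exacts [(hβ x hx).le, le_rfl, (hγ x hx).le]
    have hu0 : u ≠ [] := by rintro rfl; simp at hu
    rcases lt_or_gt_of_ne htk with hk | hk
    · obtain rfl : v = [] := by
        cases v with
        | nil => rfl
        | cons c v =>
          have := hmax c (by simp)
          have := hv c (by simp)
          omega
      have lu : ∀ x ∈ u, x < t := fun x hx => (hmax x (by simp [hx])).trans_lt hk
      rw [canon_node_iff (fun x hx => (lu x hx).trans (by omega)) (by simp), huv, List.append_nil]
      obtain ⟨b, l, rfl⟩ := List.exists_cons_of_ne_nil hu0
      simp [canon_singleton, lu b]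
    · rcases List.append_eq_append_iff.1 huv with ⟨as, h1, h2⟩ | ⟨as, h1, h2⟩
      · cases as with
        | nil =>
          obtain rfl : u = β := by simpa using h1
          obtain rfl : v = k :: γ := by simpa using h2.symm
          have hβ' : ∀ x ∈ u ++ [t + 1, t], x < k := by
            intro x hx
            simp only [List.mem_append, List.mem_cons, List.not_mem_nil, or_false] at hx
            rcases hx with hx | rfl | rfl
            exacts [hβ x hx, by omega, by omega]
          have e : u ++ (t + 1) :: t :: k :: γ = (u ++ [t + 1, t]) ++ k :: γ := by simp
          have ih := ihβ (fun h => ht (List.mem_append_left _ h))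
            (fun h => ht1 (List.mem_append_left _ h)) (List.append_nil u).symm hu (by simp)
          rw [e, canon_node_iff hβ' hγ, canon_node_iff hβ hγ, ih]
          obtain ⟨b, l, rfl⟩ := List.exists_cons_of_ne_nil hu0
          simp
        | cons k' γ₁ =>
          obtain ⟨rfl, rfl⟩ : k = k' ∧ γ = γ₁ ++ v := by simpa using h2
          subst h1
          have hγ₁ : ∃ a ∈ γ₁.getLast?, a < t := by
            rcases List.eq_nil_or_concat γ₁ with rfl | ⟨γ₁, a, rfl⟩
            · simp at hu; omega
            · simpa [List.getLast?_cons, List.getLast?_append] using hu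
          have hγ' : ∀ x ∈ γ₁ ++ (t + 1) :: t :: v, x < k := by
            intro x hx
            simp only [List.mem_append, List.mem_cons] at hx
            rcases hx with hx | rfl | rfl | hx
            exacts [hγ x (by simp [hx]), by omega, by omega, hγ x (by simp [hx])]
          have ih := ihγ (fun h => ht (List.mem_append_right _ (List.mem_cons_of_mem _ h)))
            (fun h => ht1 (List.mem_append_right _ (List.mem_cons_of_mem _ h))) rfl hγ₁ hv
          rw [List.append_assoc, List.cons_append, canon_node_iff hβ hγ', canon_node_iff hβ hγ, ih]
          have hH : HeadLt β (γ₁ ++ (t + 1) :: t :: v) ↔ HeadLt β (γ₁ ++ v) := by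
            obtain ⟨a, ha, hat⟩ := hγ₁
            constructor
            · intro h x hx
              refine h x ?_
              simp only [List.mem_append, List.mem_cons] at hx ⊢
              tauto
            · intro h x hx
              obtain ⟨b, hb, hba⟩ := h a (List.mem_append_left _ (List.mem_of_mem_getLast? ha))
              simp only [List.mem_append, List.mem_cons] at hx
              rcases hx with hx | rfl | rfl | hx
              exacts [h x (by simp [hx]), ⟨b, hb, by omega⟩, ⟨b, hb, by omega⟩,
                h x (by simp [hx])]
          rw [hH]
      · subst h1 h2
        have hβ' : ∀ x ∈ u ++ (t + 1) :: t :: as, x < k := by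
          intro x hx
          simp only [List.mem_append, List.mem_cons] at hx
          rcases hx with hx | rfl | rfl | hx
          exacts [hβ x (by simp [hx]), by omega, by omega, hβ x (by simp [hx])]
        have e : u ++ (t + 1) :: t :: (as ++ k :: γ) = (u ++ (t + 1) :: t :: as) ++ k :: γ := by
          simp
        have ih := ihβ (fun h => ht (List.mem_append_left _ h))
          (fun h => ht1 (List.mem_append_left _ h)) rfl hu (by
          cases as with
          | nil => simp
          | cons c as => simpa using hv)
        rw [e, canon_node_iff hβ' hγ, canon_node_iff hβ hγ, ih]
        obtain ⟨b, l, rfl⟩ := List.exists_cons_of_ne_nil hu0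
        simp

theorem pin_insert {t : ℕ} {u v : List ℕ} (hu : ∃ a ∈ u.getLast?, a < t)
    (hv : ∀ c ∈ v.head?, t + 1 < c) :
    pin (u ++ (t + 1) :: t :: v) = insert (t + 1) (pin (u ++ v)) := by
  obtain ⟨a, ha, hat⟩ := hu
  obtain ⟨u, rfl⟩ : ∃ u', u = u' ++ [a] := List.mem_getLast?_eq_getLast ha |> fun ⟨h, h'⟩ =>
    ⟨u.dropLast, by rw [h']; exact (List.dropLast_append_getLast h).symm⟩
  have hmid : pin (a :: (t + 1) :: t :: v) = insert (t + 1) (pin (t :: v)) := by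
    ext b
    rw [mem_pin_cons, pin_cons_cons_of_gt (by omega), Set.mem_insert_iff, or_comm]
    refine or_congr_left ⟨?_, ?_⟩
    · rintro ⟨c, v', h, -⟩
      exact (List.cons.inj h).1.symm
    · rintro rfl
      exact ⟨t, v, rfl, by omega, by omega⟩
  rw [List.append_assoc, List.singleton_append, pin_append_of_lt (by omega), hmid,
    Set.union_insert]
  cases v with
  | nil => simp
  | cons c v =>
    have hc : t + 1 < c := hv c (by simp)
    rw [List.append_assoc, List.singleton_append, pin_append_of_lt (u := u) (a := a) (by omega)]
    have : pin (t :: c :: v) = pin (a :: c :: v) := by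
      ext b
      rw [mem_pin_cons, mem_pin_cons (x := a)]
      refine or_congr_right ⟨?_, ?_⟩ <;>
      · rintro ⟨c', v', h, h1, h2⟩
        have := (List.cons.inj h).1
        exact ⟨c', v', h, by omega, h2⟩
    rw [this]

/-! ### Doubling a letter -/

theorem flatMap_substTwo_of_lt {t : ℕ} {σ : List ℕ} (h : ∀ x ∈ σ, x < t) :
    σ.flatMap (substTwo t) = σ := by
  induction σ with
  | nil => rfl
  | cons a σ ih =>
    rw [List.flatMap_cons, ih fun x hx => h x (by simp [hx])]
    simp [substTwo, h a (by simp)]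

theorem mem_substTwo {t x y : ℕ} :
    y ∈ substTwo t x ↔ (y = x ∧ x ≤ t) ∨ (y = x + 1 ∧ t ≤ x) := by
  unfold substTwo
  split_ifs <;> simp <;> omega

theorem headLt_flatMap_substTwo_iff {t : ℕ} {β γ : List ℕ} :
    HeadLt (β.flatMap (substTwo t)) (γ.flatMap (substTwo t)) ↔ HeadLt β γ := by
  have hne : ∀ x, substTwo t x ≠ [] := by
    intro x; unfold substTwo; split_ifs <;> simp
  cases β with
  | nil =>
    cases γ with
    | nil => simp
    | cons c γ => simp [hne]
  | cons b l =>
    obtain ⟨m, hm⟩ : ∃ m, substTwo t b = (if b ≤ t then b else b + 1) :: m := by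
      rcases lt_trichotomy b t with h | rfl | h
      · simp [substTwo, h, h.le]
      · simp [substTwo]
      · simp [substTwo, h.not_gt, h.not_ge, h.ne']
    rw [List.flatMap_cons, hm, List.cons_append, headLt_cons, headLt_cons]
    simp only [List.mem_flatMap, mem_substTwo]
    constructor
    · intro h x hx
      rcases le_or_gt x t with hxt | hxt
      · have := h x ⟨x, hx, Or.inl ⟨rfl, hxt⟩⟩
        split_ifs at this <;> omega
      · have := h (x + 1) ⟨x, hx, Or.inr ⟨rfl, hxt.le⟩⟩
        split_ifs at this <;> omega
    · rintro h y ⟨x, hx, hy⟩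
      have := h x hx
      split_ifs <;> omega

/-- The vertex `t` becomes the left child of a new vertex `t + 1`, which takes over its right
subtree. -/
theorem canon_flatMap_substTwo_iff {t : ℕ} {σ : List ℕ} (hσ : σ.Nodup) :
    Canon (σ.flatMap (substTwo t)) ↔ Canon σ := by
  induction σ, hσ using nodup_max_induction with
  | nil => simp
  | node β k γ hd hβ hγ ihβ ihγ =>
    rw [List.flatMap_append, List.flatMap_cons]
    rcases lt_trichotomy k t with hk | rfl | hk
    · rw [flatMap_substTwo_of_lt fun x hx => (hβ x hx).trans hk,
        flatMap_substTwo_of_lt fun x hx => (hγ x hx).trans hk]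
      simp [substTwo, hk]
    · rw [flatMap_substTwo_of_lt hβ, flatMap_substTwo_of_lt hγ]
      have e : β ++ (substTwo k k ++ γ) = (β ++ [k]) ++ (k + 1) :: γ := by simp [substTwo]
      have hβ' : ∀ x ∈ β ++ [k], x < k + 1 := by
        intro x hx
        rcases List.mem_append.1 hx with hx | hx
        · exact (hβ x hx).trans (by omega)
        · simp_all
      rw [e, canon_node_iff hβ' fun x hx => (hγ x hx).trans (by omega), canon_concat_iff hβ,
        canon_node_iff hβ hγ]
      have hH : HeadLt (β ++ [k]) γ ↔ HeadLt β γ := by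
        cases β with
        | cons b l => simp
        | nil =>
          rw [List.nil_append, headLt_cons, headLt_nil_left, List.eq_nil_iff_forall_not_mem]
          exact ⟨fun h x hx => absurd (h x hx) (hγ x hx).not_gt, fun h x hx => absurd hx (h x)⟩
      rw [hH]
    · have hl : ∀ w : List ℕ, (∀ x ∈ w, x < k) → ∀ x ∈ w.flatMap (substTwo t), x < k + 1 := by
        intro w hw y hy
        obtain ⟨x, hx, hy⟩ := List.mem_flatMap.1 hy
        have := hw x hx
        rw [mem_substTwo] at hy
        omega
      have e : substTwo t k = [k + 1] := by simp [substTwo, hk.not_gt, hk.ne']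
      rw [e, List.singleton_append, canon_node_iff (hl β hβ) (hl γ hγ), canon_node_iff hβ hγ,
        ihβ, ihγ, headLt_flatMap_substTwo_iff]

theorem pin_flatMap_substTwo {t : ℕ} {σ : List ℕ} (hσ : σ.Nodup) (hc : Canon σ) :
    pin (σ.flatMap (substTwo t)) = (fun x => if x < t then x else x + 1) '' pin σ := by
  have hlow : ∀ w : List ℕ, (∀ x ∈ w, x < t) →
      (fun x => if x < t then x else x + 1) '' pin w = pin w := by
    intro w hw
    exact (Set.image_congr (g := id) fun x hx => if_pos (hw x (mem_of_mem_pin hx))).trans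
      (Set.image_id _)
  have hne : ∀ w : List ℕ, w.flatMap (substTwo t) = [] ↔ w = [] := by
    intro w
    cases w with
    | nil => simp
    | cons x w => simp only [List.flatMap_cons, substTwo]; split_ifs <;> simp
  induction σ, hσ using nodup_max_induction with
  | nil => simp
  | node β k γ hd hβ hγ ihβ ihγ =>
    obtain ⟨cβ, cγ, hH⟩ := (canon_node_iff hβ hγ).1 hc
    ext b
    rw [List.flatMap_append, List.flatMap_cons]
    have himg : b ∈ (fun x => if x < t then x else x + 1) '' pin (β ++ k :: γ) ↔
        b ∈ (fun x => if x < t then x else x + 1) '' pin β ∨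
        b ∈ (fun x => if x < t then x else x + 1) '' pin γ ∨
        (b = (if k < t then k else k + 1) ∧ β ≠ [] ∧ γ ≠ []) := by
      simp only [Set.mem_image, mem_pin_node hβ hγ]
      constructor
      · rintro ⟨x, hx | hx | ⟨rfl, h⟩, rfl⟩
        exacts [Or.inl ⟨x, hx, rfl⟩, Or.inr (Or.inl ⟨x, hx, rfl⟩), Or.inr (Or.inr ⟨rfl, h⟩)]
      · rintro (⟨x, hx, rfl⟩ | ⟨x, hx, rfl⟩ | ⟨rfl, h⟩)
        exacts [⟨x, Or.inl hx, rfl⟩, ⟨x, Or.inr (Or.inl hx), rfl⟩,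
          ⟨k, Or.inr (Or.inr ⟨rfl, h⟩), rfl⟩]
    rw [himg]
    rcases lt_trichotomy k t with hk | rfl | hk
    · have lβ : ∀ x ∈ β, x < t := fun x hx => (hβ x hx).trans hk
      have lγ : ∀ x ∈ γ, x < t := fun x hx => (hγ x hx).trans hk
      rw [flatMap_substTwo_of_lt lβ, flatMap_substTwo_of_lt lγ, hlow β lβ, hlow γ lγ]
      simp only [substTwo, hk, if_true, List.singleton_append, mem_pin_node hβ hγ]
    · rw [flatMap_substTwo_of_lt hβ, flatMap_substTwo_of_lt hγ, hlow β hβ, hlow γ hγ]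
      have e : β ++ (substTwo k k ++ γ) = (β ++ [k]) ++ (k + 1) :: γ := by simp [substTwo]
      have hβ' : ∀ x ∈ β ++ [k], x < k + 1 := by
        intro x hx
        rcases List.mem_append.1 hx with hx | hx
        · exact (hβ x hx).trans (by omega)
        · simp_all
      have hβγ : γ ≠ [] → β ≠ [] := by
        rintro h rfl
        exact h (headLt_nil_left.1 hH)
      rw [e, mem_pin_node hβ' fun x hx => (hγ x hx).trans (by omega),
        mem_pin_node hβ (by simp)]
      simp
      tauto
    · have hl : ∀ w : List ℕ, (∀ x ∈ w, x < k) → ∀ x ∈ w.flatMap (substTwo t), x < k + 1 := by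
        intro w hw y hy
        obtain ⟨x, hx, hy⟩ := List.mem_flatMap.1 hy
        have := hw x hx
        rw [mem_substTwo] at hy
        omega
      have e : substTwo t k = [k + 1] := by simp [substTwo, hk.not_gt, hk.ne']
      rw [e, List.singleton_append, mem_pin_node (hl β hβ) (hl γ hγ), ihβ cβ, ihγ cγ,
        if_neg hk.not_gt, Ne, Ne, hne, hne]

/-! ### The inductive construction on canonical words -/

/-- The canonical permutations of `{1, …, n}` with pinnacle set `S`. -/
def IsCanonPerm (n : ℕ) (S : Finset ℕ) (σ : List ℕ) : Prop :=
  σ ∈ permWords n ∧ Canon σ ∧ pin σ = (S : Set ℕ)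

theorem three_le_of_mem_pin {n b : ℕ} {σ : List ℕ} (hσ : σ ∈ permWords n) (hb : b ∈ pin σ) :
    3 ≤ b := by
  obtain ⟨hd, hm⟩ := mem_permWords.1 hσ
  obtain ⟨u, v, a, c, rfl, ha, hc⟩ := hb
  have h1 := (hm a).1 (by simp)
  have h2 := (hm c).1 (by simp)
  have h3 : a ≠ c := by rintro rfl; simp [List.nodup_append] at hd
  omega

theorem mem_of_isCanonPerm {n x : ℕ} {S : Finset ℕ} {σ : List ℕ} (h : IsCanonPerm n S σ)
    (hx : x ∈ S) : x ∈ pin σ := by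
  rw [h.2.2]; exact hx

theorem le_of_isCanonPerm {n x : ℕ} {S : Finset ℕ} {σ : List ℕ} (h : IsCanonPerm n S σ)
    (hx : x ∈ S) : x ≤ n :=
  (((mem_permWords.1 h.1).2 x).1 (mem_of_mem_pin (mem_of_isCanonPerm h hx))).2

theorem isCanonPerm_concat_iff {n : ℕ} {S : Finset ℕ} {σ : List ℕ} (hσ : ∀ x ∈ σ, x < n + 1) :
    IsCanonPerm (n + 1) S (σ ++ [n + 1]) ↔ IsCanonPerm n S σ := by
  unfold IsCanonPerm
  refine and_congr ?_ (and_congr (canon_concat_iff hσ) ?_)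
  · rw [mem_permWords, mem_permWords]
    refine and_congr ?_ ?_
    · simp only [List.nodup_append, List.nodup_singleton, List.mem_singleton]
      exact ⟨fun h => h.1, fun h => ⟨h, trivial, fun x hx y hy => by
        rw [hy]; exact (hσ x hx).ne⟩⟩
    · refine forall_congr' fun x => ?_
      rw [List.mem_append, List.mem_singleton]
      have := hσ x
      constructor
      · intro h
        constructor
        · intro hx
          have := (h.1 (Or.inl hx)).1
          have := hσ x hx
          omega
        · intro hx
          rcases h.2 (by omega) with h | h
          exacts [h, by omega]
      · intro h
        rw [h]
        omega
  · have : pin (σ ++ [n + 1]) = pin σ := by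
      ext b; simp [mem_pin_node hσ (γ := []) (by simp)]
    rw [this]

theorem isCanonPerm_range' (n : ℕ) : IsCanonPerm n ∅ (List.range' 1 n) := by
  induction n with
  | zero => exact ⟨List.Perm.refl _, Canon.nil, by simp⟩
  | succ n ih =>
    rw [List.range'_1_concat, add_comm 1 n]
    refine (isCanonPerm_concat_iff fun x hx => ?_).2 ih
    rw [List.mem_range'_1] at hx
    omega

theorem isCanonPerm_swap {n t : ℕ} {σ : List ℕ} (ht : t < n) (ht0 : 1 ≤ t)
    {S S' : Finset ℕ} (h : IsCanonPerm n S σ)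
    (hS : ∀ b, Equiv.swap t (t + 1) b ∈ S ↔ b ∈ S')
    (hswap : Canon (σ.map (Equiv.swap t (t + 1))) ∧
      ∀ b, b ∈ pin (σ.map (Equiv.swap t (t + 1))) ↔ Equiv.swap t (t + 1) b ∈ pin σ) :
    IsCanonPerm n S' (σ.map (Equiv.swap t (t + 1))) := by
  obtain ⟨hd, hm⟩ := mem_permWords.1 h.1
  refine ⟨mem_permWords.2 ⟨hd.map (Equiv.injective _), fun x => ?_⟩, hswap.1, ?_⟩
  · have : x ∈ σ.map (Equiv.swap t (t + 1)) ↔ Equiv.swap t (t + 1) x ∈ σ := by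
      rw [List.mem_map]
      constructor
      · rintro ⟨y, hy, rfl⟩; simpa using hy
      · intro hx; exact ⟨_, hx, by simp⟩
    rw [this, hm, Equiv.swap_apply_def]
    split_ifs <;> omega
  · ext b
    rw [hswap.2, h.2.2]
    exact hS b

theorem swap_mem_iff {n t : ℕ} {T : Finset ℕ} (ht : t < n) (hT : ∀ s ∈ T, s < t) (b : ℕ) :
    Equiv.swap t (t + 1) b ∈ T ∪ {t} ∪ Icc (t + 2) n ↔ b ∈ T ∪ Icc (t + 1) n := by
  have h1 : t ∉ T := fun h => (hT t h).ne rfl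
  have h2 : t + 1 ∉ T := fun h => absurd (hT _ h) (by omega)
  simp only [mem_union, mem_singleton, mem_Icc]
  rw [Equiv.swap_apply_def]
  split_ifs with h3 h4
  · subst h3; simp [h1, h2]
  · subst h4; simp [h2]; omega
  · have : b ≠ t ∧ b ≠ t + 1 := ⟨h3, h4⟩
    simp only [this.1, or_false]
    refine or_congr_right ?_
    omega

theorem isCanonPerm_substTwo_iff {m t : ℕ} {T : Finset ℕ} {σ : List ℕ} (ht0 : 1 ≤ t)
    (htm : t ≤ m) (hT : ∀ s ∈ T, s < t) :
    IsCanonPerm (m + 1) (T ∪ Icc (t + 1) (m + 1)) (σ.flatMap (substTwo t)) ↔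
      IsCanonPerm m (T ∪ Icc t m) σ := by
  have hperm : σ.flatMap (substTwo t) ∈ permWords (m + 1) ↔ σ ∈ permWords m := by
    rw [mem_permWords, mem_permWords]
    refine and_congr ?_ ?_
    · rw [List.nodup_flatMap]
      constructor
      · rintro ⟨-, h⟩
        refine h.imp fun {a b} hab => ?_
        rintro rfl
        have : (if a ≤ t then a else a + 1) ∈ substTwo t a := by
          rw [mem_substTwo]; split_ifs <;> omega
        exact hab this this
      · intro h
        refine ⟨fun x _ => ?_, h.imp fun {a b} hab => ?_⟩
        · unfold substTwo; split_ifs <;> simp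
        · intro y ha hb
          rw [mem_substTwo] at ha hb
          omega
    · have hmem : ∀ x, x ∈ σ.flatMap (substTwo t) ↔
          (x ∈ σ ∧ x ≤ t) ∨ (1 ≤ x ∧ x - 1 ∈ σ ∧ t ≤ x - 1) := by
        intro x
        simp only [List.mem_flatMap, mem_substTwo]
        constructor
        · rintro ⟨z, hz, ⟨rfl, h⟩ | ⟨rfl, h⟩⟩
          exacts [Or.inl ⟨hz, h⟩, Or.inr ⟨by omega, hz, by simpa using h⟩]
        · rintro (⟨h1, h2⟩ | ⟨h1, h2, h3⟩)
          exacts [⟨x, h1, Or.inl ⟨rfl, h2⟩⟩, ⟨x - 1, h2, Or.inr ⟨by omega, h3⟩⟩]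
      constructor
      · intro h x
        rcases le_or_gt x t with hx | hx
        · have h1 := h x
          rw [hmem] at h1
          have : ¬ (1 ≤ x ∧ x - 1 ∈ σ ∧ t ≤ x - 1) := fun h => by omega
          simp only [hx, and_true, this, or_false] at h1
          rw [h1]; omega
        · have h1 := h (x + 1)
          rw [hmem, Nat.add_sub_cancel] at h1
          have h2 : ¬ (x + 1 ∈ σ ∧ x + 1 ≤ t) := fun h => by omega
          simp only [h2, false_or, hx.le, and_true] at h1
          have h3 : 1 ≤ x + 1 := by omega
          simp only [h3, true_and] at h1
          rw [h1]; omega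
      · intro h x
        rw [hmem, h, h]; omega
  unfold IsCanonPerm
  rw [hperm]
  refine and_congr_right fun h => ?_
  have hd := (mem_permWords.1 h).1
  rw [canon_flatMap_substTwo_iff hd]
  refine and_congr_right fun hc => ?_
  rw [pin_flatMap_substTwo hd hc]
  have hinj : Function.Injective (fun x => if x < t then x else x + 1) := by
    intro x y hxy
    simp only at hxy
    split_ifs at hxy <;> omega
  have himg : ((T ∪ Icc (t + 1) (m + 1) : Finset ℕ) : Set ℕ) =
      (fun x => if x < t then x else x + 1) '' ((T ∪ Icc t m : Finset ℕ) : Set ℕ) := by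
    ext b
    simp only [coe_union, coe_Icc, Set.mem_union, mem_coe, Set.mem_Icc, Set.mem_image]
    constructor
    · rintro (hb | hb)
      · exact ⟨b, Or.inl hb, if_pos (hT b hb)⟩
      · refine ⟨b - 1, Or.inr (by omega), ?_⟩
        rw [if_neg (by omega)]; omega
    · rintro ⟨x, hx | hx, rfl⟩
      · rw [if_pos (hT x hx)]; exact Or.inl hx
      · rw [if_neg (by omega)]; right; omega
  rw [himg, hinj.image_injective.eq_iff]

theorem shiftTwo_strictMono (t : ℕ) : StrictMono (shiftTwo t) := by
  intro x y hxy
  unfold shiftTwo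
  split_ifs <;> omega

/-- Cutting out `t + 1, t` is the inverse of the constructions that insert them after a letter
smaller than `t`, either at the end or in front of a letter which is at least `t` before the
shift. -/
theorem isCanonPerm_insert_iff {m t : ℕ} {T : Finset ℕ} {u v : List ℕ} (ht0 : 1 ≤ t)
    (htm : t ≤ m + 1) (hT : ∀ s ∈ T, s < t) (hu : ∃ a ∈ u.getLast?, a < t)
    (hv : ∀ c ∈ v.head?, t ≤ c) :
    IsCanonPerm (m + 2) (T ∪ Icc (t + 1) (m + 2))
        (u.map (shiftTwo t) ++ (t + 1) :: t :: v.map (shiftTwo t)) ↔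
      IsCanonPerm m (T ∪ Icc t m) (u ++ v) := by
  have hne : ∀ x, shiftTwo t x ≠ t ∧ shiftTwo t x ≠ t + 1 := by
    intro x; unfold shiftTwo; split_ifs <;> omega
  have h1 : t ∉ (u ++ v).map (shiftTwo t) := by
    intro h
    obtain ⟨x, -, hx⟩ := List.mem_map.1 h
    exact (hne x).1 hx
  have h2 : t + 1 ∉ (u ++ v).map (shiftTwo t) := by
    intro h
    obtain ⟨x, -, hx⟩ := List.mem_map.1 h
    exact (hne x).2 hx
  have hp : (u.map (shiftTwo t) ++ (t + 1) :: t :: v.map (shiftTwo t)).Perm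
      ((t + 1) :: t :: (u ++ v).map (shiftTwo t)) := by
    rw [List.map_append]
    exact List.perm_middle.trans (List.perm_middle.cons _)
  have hu' : ∃ a ∈ (u.map (shiftTwo t)).getLast?, a < t := by
    obtain ⟨a, ha, hat⟩ := hu
    refine ⟨shiftTwo t a, ?_, ?_⟩
    · rw [List.getLast?_map]; exact Option.mem_map_of_mem _ ha
    · rw [shiftTwo, if_pos hat]; exact hat
  have hv' : ∀ c ∈ (v.map (shiftTwo t)).head?, t + 1 < c := by
    intro c hc
    rw [List.head?_map] at hc
    obtain ⟨c, hc', rfl⟩ := Option.mem_map.1 hc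
    have := hv c hc'
    rw [shiftTwo, if_neg (by omega)]
    omega
  have hperm : u.map (shiftTwo t) ++ (t + 1) :: t :: v.map (shiftTwo t) ∈ permWords (m + 2) ↔
      u ++ v ∈ permWords m := by
    rw [mem_permWords, mem_permWords, hp.nodup_iff]
    refine and_congr ?_ ?_
    · rw [List.nodup_cons, List.nodup_cons, List.nodup_map_iff (shiftTwo_strictMono t).injective,
        List.mem_cons]
      simp [h1, h2, -List.map_append]
    · simp only [hp.mem_iff, List.mem_cons, List.mem_map]
      constructor
      · intro h x
        have h3 := h (shiftTwo t x)
        simp only [(hne x).1, (hne x).2, false_or,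
          (shiftTwo_strictMono t).injective.eq_iff, exists_eq_right] at h3
        rw [h3, shiftTwo]
        split_ifs <;> omega
      · intro h x
        simp only [h]
        constructor
        · rintro (rfl | rfl | ⟨y, hy, rfl⟩)
          · omega
          · omega
          · unfold shiftTwo; split_ifs <;> omega
        · intro hx
          by_cases hxt : x < t
          · exact Or.inr (Or.inr ⟨x, by omega, if_pos hxt⟩)
          · by_cases hx2 : t + 2 ≤ x
            · refine Or.inr (Or.inr ⟨x - 2, by omega, ?_⟩)
              rw [shiftTwo, if_neg (by omega)]; omega
            · omega
  unfold IsCanonPerm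
  rw [hperm]
  refine and_congr_right fun h => ?_
  have hd := (mem_permWords.1 h).1
  obtain ⟨hc, hpin⟩ := canon_map_iff_and_pin_map hd ((shiftTwo_strictMono t).strictMonoOn _)
  rw [canon_insert_iff (hd.map (shiftTwo_strictMono t).injective) h1 h2 List.map_append hu' hv',
    hc, pin_insert hu' hv', ← List.map_append, hpin]
  refine and_congr_right fun _ => ?_
  have hmem : ∀ x, shiftTwo t x ∈ T ∪ Icc (t + 1) (m + 2) ↔ x ∈ T ∪ Icc t m := by
    intro x
    simp only [mem_union, mem_Icc, shiftTwo]
    split_ifs with hx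
    · refine or_congr_right ?_; omega
    · have e1 : x ∉ T := fun h => hx (hT x h)
      have e2 : x + 2 ∉ T := fun h => absurd (hT _ h) (by omega)
      simp only [e1, e2, false_or]; omega
  constructor
  · intro h
    ext x
    rw [mem_coe, ← hmem, ← mem_coe, ← h, Set.mem_insert_iff, or_iff_right (hne x).2,
      (shiftTwo_strictMono t).injective.mem_set_image]
  · intro h
    rw [h]
    ext b
    rw [Set.mem_insert_iff, Set.mem_image, mem_coe]
    constructor
    · rintro (rfl | ⟨x, hx, rfl⟩)
      · simp; omega
      · exact (hmem x).2 hx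
    · intro hb
      by_cases hbt : b < t
      · have e : shiftTwo t b = b := if_pos hbt
        exact Or.inr ⟨b, (hmem b).1 (e.symm ▸ hb), e⟩
      · rcases eq_or_ne b (t + 1) with hb1 | hb1
        · exact Or.inl hb1
        · have hb' := hb
          simp only [mem_union, mem_Icc] at hb'
          have := hb'.resolve_left fun h => hbt (hT b h)
          have e : shiftTwo t (b - 2) = b := by
            unfold shiftTwo; split_ifs <;> omega
          exact Or.inr ⟨b - 2, (hmem _).1 (e.symm ▸ hb), e⟩

theorem flatMap_substThree_of_notMem {t q : ℕ} {l : List ℕ} (h : q ∉ l) :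
    l.flatMap (substThree t q) = l.map (shiftTwo t) := by
  induction l with
  | nil => rfl
  | cons a l ih =>
    have ha : a ≠ q := by rintro rfl; simp at h
    rw [List.flatMap_cons, ih fun h' => h (by simp [h']), List.map_cons, substThree, shiftTwo]
    split_ifs <;> simp_all

theorem flatMap_substThree {t q : ℕ} {u v : List ℕ} (hd : (u ++ q :: v).Nodup) (hq : t ≤ q) :
    (u ++ q :: v).flatMap (substThree t q) =
      u.map (shiftTwo t) ++ (t + 1) :: t :: (q :: v).map (shiftTwo t) := by
  have hu : q ∉ u := fun h => (List.nodup_append.1 hd).2.2 q h q (by simp) rfl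
  have hv : q ∉ v := (List.nodup_cons.1 (List.nodup_append.1 hd).2.1).1
  rw [List.flatMap_append, List.flatMap_cons, flatMap_substThree_of_notMem hu,
    flatMap_substThree_of_notMem hv]
  simp [substThree, shiftTwo, hq.not_gt]

theorem isCanonPerm_of_inPPrime {n : ℕ} {S : Finset ℕ} {σ : List ℕ} (h : InPPrime n S σ) :
    IsCanonPerm n S σ := by
  induction h with
  | identity n => exact isCanonPerm_range' n
  | append n S σ hS hσ ih =>
    refine (isCanonPerm_concat_iff fun x hx => ?_).2 ih
    have := ((mem_permWords.1 ih.1).2 x).1 hx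
    omega
  | first n t S T σ hS hσ ih =>
    obtain ⟨-, htn, hT, rfl⟩ := hS
    obtain ⟨hd, hm⟩ := mem_permWords.1 ih.1
    have htp : t ∈ pin σ := mem_of_isCanonPerm ih (by simp)
    refine isCanonPerm_swap htn ((hm t).1 (mem_of_mem_pin htp)).1 ih (swap_mem_iff htn hT)
      (map_swap_of_mem_pin hd ih.2.1 (fun _ => htp) ?_)
    rw [ih.2.2]
    have : t + 1 ∉ T := fun h => absurd (hT _ h) (by omega)
    simp [this]
  | second m t S T σ hS hσ ih =>
    obtain ⟨-, htn, hT, rfl⟩ := hS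
    have ht0 := three_le_of_mem_pin ih.1 (mem_of_isCanonPerm ih (x := t) (by simp; omega))
    exact (isCanonPerm_substTwo_iff (by omega) (by omega) hT).2 ih
  | third m t q S T σ hS hq hσ ih =>
    obtain ⟨-, htn, hT, rfl⟩ := hS
    obtain ⟨hd, hm⟩ := mem_permWords.1 ih.1
    have ht0 := three_le_of_mem_pin ih.1 (mem_of_isCanonPerm ih (x := t) (by simp; omega))
    have hqp : q ∈ pin σ := mem_of_isCanonPerm ih (by simp; omega)
    obtain ⟨u, v, rfl⟩ := List.append_of_mem (mem_of_mem_pin hqp)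
    obtain ⟨⟨u, a, rfl, haq⟩, -⟩ := neighbours_lt_of_mem_pin hd hqp
    rw [flatMap_substThree hd hq.1]
    refine (isCanonPerm_insert_iff (by omega) (by omega) hT ⟨a, by simp, ?_⟩
      (by simpa using hq.1)).2 ih
    -- a letter that is at least `t` is a pinnacle, so it cannot be followed by a larger one
    by_contra hat
    have ham : a ≤ m := ((hm a).1 (by simp)).2
    have hap : a ∈ pin (u ++ [a] ++ q :: v) := mem_of_isCanonPerm ih (by simp; omega)
    rw [List.append_assoc, List.singleton_append] at hap hd
    obtain ⟨-, c, v', h1, h2⟩ := neighbours_lt_of_mem_pin hd hap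
    have := (List.cons.inj h1).1
    omega
  | glue m t S T σ hS hσ ih =>
    obtain ⟨⟨n', τ, hτ⟩, htn, hT, rfl⟩ := hS
    obtain ⟨hd, hm⟩ := mem_permWords.1 ih.1
    -- for `m = 0` the block would be `{2}`, which is not a pinnacle set
    have hm1 : 1 ≤ m := by
      have := three_le_of_mem_pin hτ.1 (b := m + 2) (by rw [hτ.2]; simp; omega)
      omega
    have ht0 : 1 ≤ t := by
      by_contra h
      have := three_le_of_mem_pin ih.1 (mem_of_isCanonPerm ih (x := t) (by simp; omega))
      omega
    have hne : σ ≠ [] := List.ne_nil_of_mem ((hm 1).2 ⟨le_rfl, hm1⟩)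
    have := (isCanonPerm_insert_iff (m := m) (u := σ) (v := []) ht0 (by omega) hT ?_ (by simp)).2
      (by simpa using ih)
    · simpa using this
    · obtain ⟨u, a, rfl⟩ := (List.eq_nil_or_concat σ).resolve_left hne
      refine ⟨a, by simp, ?_⟩
      by_contra hat
      have ham : a ≤ m := ((hm a).1 (by simp)).2
      have hap := mem_of_isCanonPerm ih (x := a) (by simp; omega)
      rw [List.concat_eq_append] at hap hd
      obtain ⟨-, c, v', h1, -⟩ := neighbours_lt_of_mem_pin hd hap
      simp at h1

theorem eq_concat_of_notMem {n : ℕ} {S : Finset ℕ} {σ : List ℕ} (h : IsCanonPerm (n + 1) S σ)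
    (hn : n + 1 ∉ S) : ∃ β : List ℕ, (∀ x ∈ β, x < n + 1) ∧ σ = β ++ [n + 1] := by
  obtain ⟨hd, hm⟩ := mem_permWords.1 h.1
  obtain ⟨β, γ, rfl⟩ := List.append_of_mem ((hm (n + 1)).2 (by omega))
  obtain ⟨lβ, lγ⟩ := lt_of_split hd fun x hx => by
    have := (hm x).1 hx
    omega
  refine ⟨β, lβ, ?_⟩
  have hp : n + 1 ∉ pin (β ++ (n + 1) :: γ) := by rw [h.2.2]; exact hn
  have hH := ((canon_node_iff lβ lγ).1 h.2.1).2.2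
  suffices γ = [] by rw [this]
  by_contra hγ
  refine hp ((mem_pin_node lβ lγ).2 (Or.inr (Or.inr ⟨rfl, ?_, hγ⟩)))
  rintro rfl
  exact hγ (headLt_nil_left.1 hH)

/-- A canonical word whose largest letter is a pinnacle is produced by one of the three
substitution rules, according to the position of `t` relative to `t + 1` in its decreasing
tree. -/
theorem inPPrime_of_isCanonPerm {n : ℕ} {S : Finset ℕ} {σ : List ℕ} (h : IsCanonPerm n S σ) :
    InPPrime n S σ := by
  induction n using Nat.strong_induction_on generalizing S σ with
  | _ n ihn =>
  induction hsum : ∑ s ∈ S, s using Nat.strong_induction_on generalizing S σ with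
  | _ N ihS =>
  by_cases hnS : n ∈ S
  swap
  · rcases n with _ | n
    · obtain rfl : σ = [] := by simpa using (show σ.Perm _ from h.1)
      obtain rfl : S = ∅ := by simpa using h.2.2.symm
      exact InPPrime.identity 0
    · obtain ⟨β, hβ, rfl⟩ := eq_concat_of_notMem h hnS
      have hβ' := (isCanonPerm_concat_iff hβ).1 h
      exact InPPrime.append n S β (fun s hs => le_of_isCanonPerm hβ' hs) (ihn n (by omega) hβ')
  obtain ⟨hd, hm⟩ := mem_permWords.1 h.1
  have h3 : ∀ s ∈ S, 3 ≤ s := fun s hs => three_le_of_mem_pin h.1 (mem_of_isCanonPerm h hs)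
  have hn3 := h3 n hnS
  obtain ⟨t, ht0, htn, htS, htop⟩ : ∃ t, 1 ≤ t ∧ t < n ∧ t ∉ S ∧ ∀ s, t < s → s ≤ n → s ∈ S := by
    have h1 : 1 ∉ S := fun h => absurd (h3 1 h) (by omega)
    refine ⟨Nat.findGreatest (· ∉ S) n, Nat.le_findGreatest (by omega) h1, ?_,
      Nat.findGreatest_spec (P := (· ∉ S)) (m := 1) (by omega) h1, fun s h1 h2 => ?_⟩
    · refine lt_of_le_of_ne (Nat.findGreatest_le n) fun he => ?_
      have := Nat.findGreatest_spec (P := (· ∉ S)) (m := 1) (n := n) (by omega) h1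
      rw [he] at this
      exact this hnS
    · simpa using Nat.findGreatest_is_greatest h1 h2
  obtain ⟨T, hT, hST⟩ : ∃ T : Finset ℕ, (∀ s ∈ T, s < t) ∧ S = T ∪ Icc (t + 1) n := by
    refine ⟨S.filter (· < t), by simp, ?_⟩
    ext s
    simp only [mem_union, mem_filter, mem_Icc]
    constructor
    · intro hs
      have := le_of_isCanonPerm h hs
      have : s ≠ t := by rintro rfl; exact htS hs
      by_cases hst : s < t
      exacts [Or.inl ⟨hs, hst⟩, Or.inr (by omega)]
    · rintro (hs | hs)
      exacts [hs.1, htop s (by omega) hs.2]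
  have hblock : IsBlock S T t n := ⟨⟨n, σ, h.1, h.2.2⟩, htn, hT, hST⟩
  have htp : t ∉ pin σ := by rw [h.2.2]; exact htS
  have ht1p : t + 1 ∈ pin σ := mem_of_isCanonPerm h (htop _ (by omega) (by omega))
  obtain ⟨m, rfl⟩ : ∃ m, n = m + 2 := ⟨n - 2, by omega⟩
  by_cases hA : ∃ u v, σ = u ++ t :: (t + 1) :: v
  · -- `t` is the left child of `t + 1`
    obtain ⟨u, v, rfl⟩ := hA
    have e : ∀ w : List ℕ, (∀ x ∈ w, x ≠ t ∧ x ≠ t + 1) →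
        (w.map fun x => if x ≤ t then x else x - 1).flatMap (substTwo t) = w := by
      intro w hw
      induction w with
      | nil => rfl
      | cons x w ih =>
        rw [List.map_cons, List.flatMap_cons, ih fun y hy => hw y (by simp [hy])]
        have := hw x (by simp)
        rcases lt_or_gt_of_ne this.1 with hx | hx
        · simp [substTwo, hx, hx.le]
        · have h1 : ¬ x - 1 < t := by omega
          have h2 : x - 1 ≠ t := by omega
          have h4 : x - 1 + 1 = x := by omega
          simp [substTwo, hx.not_ge, h1, h2, h4]
    have hσ : ((u.map fun x => if x ≤ t then x else x - 1) ++
        t :: v.map fun x => if x ≤ t then x else x - 1).flatMap (substTwo t) =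
          u ++ t :: (t + 1) :: v := by
      simp only [List.nodup_append, List.nodup_cons, List.mem_cons] at hd
      rw [List.flatMap_append, List.flatMap_cons, e u, e v]
      · simp [substTwo]
      · intro x hx
        constructor <;> rintro rfl <;> simp_all
      · intro x hx
        exact ⟨hd.2.2 x hx t (by simp), hd.2.2 x hx (t + 1) (by simp)⟩
    rw [hST] at h
    rw [← hσ] at h ⊢
    refine InPPrime.second (m + 1) t S T _ hblock (ihn (m + 1) (by omega) ?_)
    exact (isCanonPerm_substTwo_iff ht0 (by omega) hT).1 h
  by_cases hB : ∃ u v, σ = u ++ (t + 1) :: t :: v ∧ ∀ c ∈ v.head?, t + 1 < c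
  · -- `t` is a leaf and the right child of `t + 1`
    obtain ⟨u, v, rfl, hv⟩ := hB
    have e : ∀ w : List ℕ, (∀ x ∈ w, x ≠ t ∧ x ≠ t + 1) →
        (w.map fun x => if x < t then x else x - 2).map (shiftTwo t) = w := by
      intro w hw
      rw [List.map_map]
      conv_rhs => rw [← List.map_id w]
      refine List.map_congr_left fun x hx => ?_
      have := hw x hx
      simp only [Function.comp, shiftTwo, id]
      split_ifs <;> omega
    obtain ⟨⟨u₀, a, rfl, hat⟩, -⟩ := neighbours_lt_of_mem_pin hd ht1p
    set u := u₀ ++ [a] with hu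
    have hd' := hd
    simp only [List.nodup_append (l₁ := u), List.nodup_cons, List.mem_cons] at hd'
    have eu := e u fun x hx =>
      ⟨hd'.2.2 x hx t (by simp), hd'.2.2 x hx (t + 1) (by simp)⟩
    have ev := e v fun x hx => by
      constructor <;> rintro rfl <;> simp_all
    have hat' : a < t := by
      have := hd'.2.2 a (by simp [hu]) t (by simp)
      omega
    rw [hST] at h
    rw [← eu, ← ev] at h ⊢
    have hlast : ∃ b ∈ (u.map fun x => if x < t then x else x - 2).getLast?, b < t :=
      ⟨a, by simp [hu, hat'], hat'⟩
    have hhead : ∀ c ∈ (v.map fun x => if x < t then x else x - 2).head?, t ≤ c := by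
      intro c hc
      rw [List.head?_map] at hc
      obtain ⟨c, hc', rfl⟩ := Option.mem_map.1 hc
      have := hv c hc'
      rw [if_neg] <;> omega
    have h' := (isCanonPerm_insert_iff ht0 (by omega) hT hlast hhead).1 h
    have ih := ihn m (by omega) h'
    generalize (u.map fun x => if x < t then x else x - 2) = u' at *
    generalize (v.map fun x => if x < t then x else x - 2) = v' at *
    obtain ⟨hd1, hm1⟩ := mem_permWords.1 h'.1
    cases v' with
    | nil => simpa using InPPrime.glue m t S T u' hblock (by simpa using ih)
    | cons q v' =>
      have hq : t ≤ q := hhead q rfl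
      rw [← flatMap_substThree hd1 hq]
      exact InPPrime.third m t q S T _ hblock ⟨hq, ((hm1 q).1 (by simp)).2⟩ ih
  · -- exchanging `t` and `t + 1` keeps `n` and lowers the sum of the pinnacles by one
    have hswap := map_swap_of_succ_mem_pin hd h.2.1 (fun _ => ht1p) htp
      (fun u v he => hA ⟨u, v, he⟩) (fun u v he hv => hB ⟨u, v, he, hv⟩)
    have hS' : ∀ b, Equiv.swap t (t + 1) b ∈ S ↔ b ∈ T ∪ {t} ∪ Icc (t + 2) (m + 2) := by
      intro b
      rw [hST, ← swap_mem_iff htn hT, Equiv.swap_apply_self]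
    have hgood := isCanonPerm_swap htn ht0 h hS' hswap
    have hlt : ∑ s ∈ T ∪ {t} ∪ Icc (t + 2) (m + 2), s < N := by
      have e : T ∪ {t} ∪ Icc (t + 2) (m + 2) = insert t (S.erase (t + 1)) := by
        rw [hST]
        ext s
        have : s ∈ T → s ≠ t + 1 := fun hs => by
          have := hT s hs
          omega
        simp only [mem_union, mem_singleton, mem_Icc, mem_insert, mem_erase]
        by_cases hs : s ∈ T
        · simp [hs, this hs]
        · simp only [hs, false_or]; omega
      have h1 := Finset.add_sum_erase S (fun s => s) (htop (t + 1) (by omega) (by omega))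
      rw [e, Finset.sum_insert (by simp [htS]), ← hsum, ← h1]
      omega
    have := InPPrime.first (m + 2) t S T _ hblock (ihS _ hlt hgood rfl)
    rw [List.map_map] at this
    have hid : (Equiv.swap t (t + 1) : ℕ → ℕ) ∘ Equiv.swap t (t + 1) = id := by
      ext x; simp
    rwa [hid, List.map_id] at this

end Pinnacle

theorem mainTheorem2 (n : ℕ) (hn : 1 ≤ n) (S : Finset ℕ) (hS : Pinnacle.IsPinnacleSet S)
    (hmax : ∀ s ∈ S, s ≤ n) :
    (∀ σ ∈ Pinnacle.permsWithPin n S, Pinnacle.fsOrbit σ ⊆ Pinnacle.permsWithPin n S) ∧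
    Pinnacle.PPrime n S =
      {σ | σ ∈ Pinnacle.permsWithPin n S ∧ IsLeast (Pinnacle.fsOrbit σ) σ} ∧
    (Pinnacle.PPrime n S).ncard * 2 ^ (n - 1 - S.card) = Pinnacle.p n S := by
  have key : Pinnacle.PPrime n S =
      {σ | σ ∈ Pinnacle.permsWithPin n S ∧ IsLeast (Pinnacle.fsOrbit σ) σ} := by
    ext σ
    constructor
    · intro h
      have h := Pinnacle.isCanonPerm_of_inPPrime h
      exact ⟨⟨h.1, h.2.2⟩,
        (Pinnacle.isLeast_fsOrbit_iff (Pinnacle.mem_permWords.1 h.1).1).2 h.2.1⟩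
    · rintro ⟨h, hl⟩
      exact Pinnacle.inPPrime_of_isCanonPerm
        ⟨h.1, (Pinnacle.isLeast_fsOrbit_iff (Pinnacle.mem_permWords.1 h.1).1).1 hl, h.2⟩
  refine ⟨fun σ hσ => Pinnacle.fsOrbit_subset_permsWithPin hσ, key, ?_⟩
  rw [key]
  exact Pinnacle.ncard_isLeast_mul hn S
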